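/- Let $N\ge 1$ be an integer, $I=(0,1)$, and let $m\in C([0,1])$ satisfy $\operatorname{meas}\{r\in I: m(r)>0\}\neq 0$. For $p\in(1,\infty)$ and $\varphi_p(s)=|s|^{p-2}s$ (with $\varphi_p(0)=0$), consider the eigenvalue problem for the radial weighted $p$-Laplacian on the unit ball of $\mathbb{R}^N$, $$\bigl(r^{N-1}\varphi_p(u')\bigr)'+\mu\,m(r)\,r^{N-1}\varphi_p(u)=0\ \text{ for a.e. } r\in I,\qquad u'(0)=u(1)=0 .$$ A solution is a function $u\in C^1([0,1])$ with $u'(0)=u(1)=0$ such that $r^{N-1}\varphi_p(u')$ is absolutely continuous on $[0,1]$ and the equation holds a.e. in $I$; a number $\mu\in\mathbb{R}$ is an eigenvalue if there is a solution $u\not\equiv 0$. Then for every $p\in(1,\infty)$ there is a smallest positive eigenvalue $\mu_1^+(p)$, and the function $\mu_1^+:(1,\infty)\to\mathbb{R}$ is continuous. If moreover $m$ changes sign, that is, $\operatorname{meas}\{r\in I: m(r)<0\}\neq 0$ as well, then for every $p\in(1,\infty)$ there is a largest negative eigenvalue $\mu_1^-(p)$, and the function $\mu_1^-:(1,\infty)\to\mathbb{R}$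 is continuous. -/

import Mathlib

open Set MeasureTheory

/-- The function `φ_p(s) = |s|^(p-2) s`; for `p > 1` it is continuous with `φ_p(0) = 0`. -/
noncomputable def phi (p s : ℝ) : ℝ := |s| ^ (p - 2) * s

/-- The class `M(I)`, `I = (0,1)`: continuous radial weights on `[0,1]` whose positivity set
in `(0,1)` has nonzero Lebesgue measure. -/
def WeightClass (m : ℝ → ℝ) : Prop :=
  ContinuousOn m (Icc 0 1) ∧ volume {r | r ∈ Ioo (0 : ℝ) 1 ∧ 0 < m r} ≠ 0

/-- `u` is a solution of the radial weighted `p`-Laplacian problem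
`(r^(N-1) φ_p(u'))' + μ m(r) r^(N-1) φ_p(u) = 0` a.e. in `(0,1)`, `u'(0) = u(1) = 0`:
`u` is of class `C¹` on `[0,1]`, satisfies the boundary conditions, the flux `r^(N-1) φ_p(u')` is
absolutely continuous on `[0,1]`, and the equation holds almost everywhere. -/
structure IsRadialSolution (N : ℕ) (m : ℝ → ℝ) (p μ : ℝ) (u : ℝ → ℝ) : Prop where
  contDiffOn : ContDiffOn ℝ 1 u (Icc 0 1)
  deriv_zero : derivWithin u (Icc 0 1) 0 = 0
  apply_one : u 1 = 0
  absolutelyContinuous : AbsolutelyContinuousOnInterval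
    (fun r : ℝ => r ^ (N - 1) * phi p (derivWithin u (Icc 0 1) r)) 0 1
  equation : ∀ᵐ r ∂(volume.restrict (Ioo (0 : ℝ) 1)),
    HasDerivAt (fun r : ℝ => r ^ (N - 1) * phi p (derivWithin u (Icc 0 1) r))
      (-(μ * m r * r ^ (N - 1) * phi p (u r))) r

/-- `μ` is an eigenvalue: the problem has a solution which is not identically zero on `[0,1]`. -/
def IsRadialEigenvalue (N : ℕ) (m : ℝ → ℝ) (p μ : ℝ) : Prop :=
  ∃ u : ℝ → ℝ, IsRadialSolution N m p μ u ∧ ∃ r ∈ Icc (0 : ℝ) 1, u r ≠ 0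

/-- The set of positive eigenvalues. -/
def posEigenvalues (N : ℕ) (m : ℝ → ℝ) (p : ℝ) : Set ℝ :=
  {μ | 0 < μ ∧ IsRadialEigenvalue N m p μ}

/-- The set of negative eigenvalues. -/
def negEigenvalues (N : ℕ) (m : ℝ → ℝ) (p : ℝ) : Set ℝ :=
  {μ | μ < 0 ∧ IsRadialEigenvalue N m p μ}

/-- The principal positive eigenvalue `μ₁⁺(p)`, the smallest positive one. -/
noncomputable def muOnePos (N : ℕ) (m : ℝ → ℝ) (p : ℝ) : ℝ := sInf (posEigenvalues N m p)

/-- The principal negative eigenvalue `μ₁⁻(p)`, the largest negative one. -/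
noncomputable def muOneNeg (N : ℕ) (m : ℝ → ℝ) (p : ℝ) : ℝ := sSup (negEigenvalues N m p)

/-! Write n = N - 1 and p' = p/(p-1). Integrating the equation twice gives `IsMildSolution`: u' =
-φ_{p'}(flux), where the flux is an average with no singularity at r = 0. In this form, bounded
families of solutions are compact by Arzelà–Ascoli, jointly in p and μ
(`exists_subseq_tendsto_isMildSolution`). After normalization, limits of eigenvalues are therefore
eigenvalues (`IsMildEigenvalue.of_tendsto`); since 0 is not one, positive eigenvalues stay away from
0. This gives a least element as soon as one positive eigenvalue exists, and also lower
semicontinuity in p.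

The other half is a Rayleigh quotient bound. If (0,c] contains no eigenvalue, a positive solution
persists from μ = 0 up to μ = c (`exists_pos_isMildSolution`): positivity is a closed condition by
compactness and the strong maximum principle, and an open one by stability of the Riccati equation
satisfied by t^n φ_p(u'/u). Picone's inequality against that solution gives c ∫ t^n m |v|^p ≤ ∫ t^n
|v'|^p for every C¹ function v with v(1) = 0. So a test function violating this forces an eigenvalue
in (0,c]. A bump supported where m > 0 gives existence. The eigenfunction at p, for which the energy
identity is an equality, serves as a test function for nearby exponents and gives upper
semicontinuity.

The negative eigenvalue follows by replacing (m, μ) with (-m, -μ). -/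

open Filter Topology

/-! ### The nonlinearity φ_p: inversion, homogeneity, joint continuity. -/

section Phi

lemma phi_zero (p : ℝ) : phi p 0 = 0 := by simp [phi]

lemma phi_neg (p x : ℝ) : phi p (-x) = -phi p x := by simp [phi]

lemma phi_of_pos {p x : ℝ} (hx : 0 < x) : phi p x = x ^ (p - 1) := by
  rw [phi, abs_of_pos hx, show p - 1 = (p - 2) + 1 by ring, Real.rpow_add_one hx.ne']

/-- Here the exponent p - 1 is positive, so continuity in (p, x) is visible even at x = 0, where the
factor |x|^(p-2) is singular for p < 2. -/
lemma phi_eq_max_sub_max {p : ℝ} (hp : 1 < p) (x : ℝ) :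
    phi p x = max x 0 ^ (p - 1) - max (-x) 0 ^ (p - 1) := by
  have h0 : (0 : ℝ) ^ (p - 1) = 0 := Real.zero_rpow (by linarith)
  rcases lt_trichotomy x 0 with h | rfl | h
  · have : phi p x = -phi p (-x) := by rw [phi_neg, neg_neg]
    rw [this, phi_of_pos (by linarith), max_eq_right h.le, max_eq_left (by linarith), h0, zero_sub]
  · simp [phi_zero]
  · rw [phi_of_pos h, max_eq_left h.le, max_eq_right (by linarith), h0, sub_zero]

lemma abs_phi {p : ℝ} (hp : 1 < p) (x : ℝ) : |phi p x| = |x| ^ (p - 1) := by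
  rcases eq_or_ne x 0 with rfl | h
  · simp [phi_zero, Real.zero_rpow (show p - 1 ≠ 0 by linarith)]
  · rw [phi, abs_mul, abs_of_nonneg (Real.rpow_nonneg (abs_nonneg x) _),
      show p - 1 = (p - 2) + 1 by ring, Real.rpow_add_one (abs_ne_zero.2 h)]

lemma phi_mul_self {p : ℝ} (hp : 1 < p) (x : ℝ) : phi p x * x = |x| ^ p := by
  rcases eq_or_ne x 0 with rfl | h
  · simp [Real.zero_rpow (show p ≠ 0 by linarith)]
  · rw [phi, mul_assoc, ← abs_mul_abs_self x, ← mul_assoc, ← Real.rpow_add_one (abs_ne_zero.2 h),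
      ← Real.rpow_add_one (abs_ne_zero.2 h)]
    congr 1; ring

lemma phi_mul {p c : ℝ} (hc : 0 < c) (x : ℝ) : phi p (c * x) = c ^ (p - 1) * phi p x := by
  rw [phi, phi, abs_mul, abs_of_pos hc, Real.mul_rpow hc.le (abs_nonneg x),
    show p - 1 = (p - 2) + 1 by ring, Real.rpow_add_one hc.ne']
  ring

lemma one_lt_conj {p : ℝ} (hp : 1 < p) : 1 < p / (p - 1) := by
  rw [one_lt_div (by linarith)]; linarith

lemma conj_conj {p : ℝ} (hp : 1 < p) : p / (p - 1) / (p / (p - 1) - 1) = p := by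
  have : p - 1 ≠ 0 := by linarith
  field_simp
  ring

lemma conj_sub_one {p : ℝ} (hp : 1 < p) : p / (p - 1) - 1 = (p - 1)⁻¹ := by
  have : p - 1 ≠ 0 := by linarith
  field_simp
  ring

lemma phi_phi_conj {p : ℝ} (hp : 1 < p) (x : ℝ) : phi p (phi (p / (p - 1)) x) = x := by
  have hq := conj_sub_one hp
  have key : ∀ y : ℝ, 0 < y → phi p (phi (p / (p - 1)) y) = y := fun y hy => by
    rw [phi_of_pos hy, phi_of_pos (Real.rpow_pos_of_pos hy _), hq,
      Real.rpow_inv_rpow hy.le (by linarith)]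
  rcases lt_trichotomy x 0 with h | rfl | h
  · have := key (-x) (by linarith)
    rw [phi_neg, phi_neg] at this
    linarith
  · simp [phi_zero]
  · exact key x h

lemma phi_conj_phi {p : ℝ} (hp : 1 < p) (x : ℝ) : phi (p / (p - 1)) (phi p x) = x := by
  have := phi_phi_conj (one_lt_conj hp) x
  rwa [conj_conj hp] at this

lemma continuousAt_phi {p : ℝ} (hp : 1 < p) (x : ℝ) :
    ContinuousAt (fun y : ℝ × ℝ => phi y.1 y.2) (p, x) := by
  have h : (fun y : ℝ × ℝ => max y.2 0 ^ (y.1 - 1) - max (-y.2) 0 ^ (y.1 - 1)) =ᶠ[𝓝 (p, x)]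
      fun y : ℝ × ℝ => phi y.1 y.2 := by
    filter_upwards [(isOpen_lt continuous_const continuous_fst).mem_nhds
      (show (1 : ℝ) < ((p, x) : ℝ × ℝ).1 from hp)] with y hy
    exact (phi_eq_max_sub_max hy _).symm
  refine ContinuousAt.congr ?_ h
  have h0 : (0 : ℝ) < p - 1 := by linarith
  have h1 : ContinuousAt (fun y : ℝ × ℝ => max y.2 0 ^ (y.1 - 1)) (p, x) :=
    ContinuousAt.rpow (by fun_prop) (by fun_prop) (Or.inr h0)
  have h2 : ContinuousAt (fun y : ℝ × ℝ => max (-y.2) 0 ^ (y.1 - 1)) (p, x) :=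
    ContinuousAt.rpow (by fun_prop) (by fun_prop) (Or.inr h0)
  exact h1.sub h2

lemma continuous_phi {p : ℝ} (hp : 1 < p) : Continuous (phi p) := by
  rw [continuous_iff_continuousAt]
  intro x
  exact (continuousAt_phi hp x).comp (f := fun x => (p, x)) (by fun_prop)

lemma tendsto_phi {ι : Type*} {l : Filter ι} {p : ι → ℝ} {x : ι → ℝ} {p₀ x₀ : ℝ} (hp₀ : 1 < p₀)
    (hp : Tendsto p l (𝓝 p₀)) (hx : Tendsto x l (𝓝 x₀)) :
    Tendsto (fun i => phi (p i) (x i)) l (𝓝 (phi p₀ x₀)) :=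
  (continuousAt_phi hp₀ x₀).tendsto.comp (hp.prodMk_nhds hx)

/-- The base 1 + B is at least 1, so the bound is monotone in the exponent and hence uniform in p ≤
P; it supplies the dominating functions when p varies. -/
lemma abs_phi_le {p P x B : ℝ} (hp : 1 < p) (hP : p ≤ P) (hx : |x| ≤ B) :
    |phi p x| ≤ (1 + B) ^ P := by
  have hB : 0 ≤ B := (abs_nonneg x).trans hx
  rw [abs_phi hp]
  calc |x| ^ (p - 1) ≤ (1 + B) ^ (p - 1) :=
        Real.rpow_le_rpow (abs_nonneg x) (by linarith) (by linarith)
    _ ≤ (1 + B) ^ P := Real.rpow_le_rpow_of_exponent_le (by linarith) (by linarith)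

end Phi

/-! ### The integral form of the equation. -/

section Flux

/-- The averaged form of `r^(-n) ∫₀ʳ μ m sⁿ φ_p(u) ds`, free of the singularity at `r = 0`. -/
noncomputable def flux (n : ℕ) (m : ℝ → ℝ) (p μ : ℝ) (u : ℝ → ℝ) (t : ℝ) : ℝ :=
  μ * t * ∫ σ in (0 : ℝ)..1, σ ^ n * m (t * σ) * phi p (u (t * σ))

variable {n : ℕ} {m : ℝ → ℝ} {p μ : ℝ} {u : ℝ → ℝ}

lemma flux_zero : flux n m p μ u 0 = 0 := by simp [flux]

lemma continuous_flux (hm : Continuous m) (hp : 1 < p) (hu : Continuous u) :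
    Continuous (flux n m p μ u) := by
  have hφ := continuous_phi hp
  refine Continuous.mul (by fun_prop) ?_
  apply intervalIntegral.continuous_parametric_intervalIntegral_of_continuous'
  simp only [Function.uncurry_def]
  fun_prop

/-- Substitution s = tσ. -/
lemma pow_mul_flux (t : ℝ) :
    t ^ n * flux n m p μ u t = ∫ s in (0 : ℝ)..t, μ * m s * s ^ n * phi p (u s) := by
  have h := intervalIntegral.mul_integral_comp_mul_left (a := 0) (b := 1) (c := t)
    (f := fun s => μ * m s * s ^ n * phi p (u s))
  rw [mul_zero, mul_one] at h
  rw [← h, flux, mul_comm μ t, mul_assoc, mul_left_comm, ← intervalIntegral.integral_const_mul,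
    ← intervalIntegral.integral_const_mul]
  congr 1
  refine intervalIntegral.integral_congr fun σ _ => ?_
  simp only [mul_pow]
  ring

lemma hasDerivAt_pow_mul_flux (hm : Continuous m) (hp : 1 < p) (hu : Continuous u) (t : ℝ) :
    HasDerivAt (fun t => t ^ n * flux n m p μ u t) (μ * m t * t ^ n * phi p (u t)) t := by
  have hφ := continuous_phi hp
  have hc : Continuous fun s => μ * m s * s ^ n * phi p (u s) := by fun_prop
  simp only [pow_mul_flux]
  exact hc.integral_hasStrictDerivAt 0 t |>.hasDerivAt

/-- Integral form of the radial equation, without the condition at `r = 1`. -/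
structure IsMildSolution (n : ℕ) (m : ℝ → ℝ) (p μ : ℝ) (u : ℝ → ℝ) : Prop where
  continuous : Continuous u
  eqn : ∀ r ∈ Icc (0 : ℝ) 1,
    u r = u 0 - ∫ t in (0 : ℝ)..r, phi (p / (p - 1)) (flux n m p μ u t)

lemma IsMildSolution.hasDerivWithinAt (h : IsMildSolution n m p μ u) (hm : Continuous m)
    (hp : 1 < p) {r : ℝ} (hr : r ∈ Icc (0 : ℝ) 1) :
    HasDerivWithinAt u (-phi (p / (p - 1)) (flux n m p μ u r)) (Icc 0 1) r := by
  have hc : Continuous fun t => phi (p / (p - 1)) (flux n m p μ u t) :=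
    (continuous_phi (one_lt_conj hp)).comp (continuous_flux hm hp h.continuous)
  have h1 : HasDerivAt (fun r => u 0 - ∫ t in (0 : ℝ)..r, phi (p / (p - 1)) (flux n m p μ u t))
      (-phi (p / (p - 1)) (flux n m p μ u r)) r := by
    have h2 := (hc.integral_hasStrictDerivAt 0 r).hasDerivAt
    exact h2.const_sub (u 0)
  exact h1.hasDerivWithinAt.congr h.eqn (h.eqn r hr)

lemma IsMildSolution.hasDerivAt (h : IsMildSolution n m p μ u) (hm : Continuous m)
    (hp : 1 < p) {r : ℝ} (hr : r ∈ Ioo (0 : ℝ) 1) :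
    HasDerivAt u (-phi (p / (p - 1)) (flux n m p μ u r)) r :=
  (h.hasDerivWithinAt hm hp (Ioo_subset_Icc_self hr)).hasDerivAt (Icc_mem_nhds hr.1 hr.2)

lemma flux_smul {c : ℝ} (hc : 0 < c) (t : ℝ) :
    flux n m p μ (fun r => c * u r) t = c ^ (p - 1) * flux n m p μ u t := by
  simp only [flux, phi_mul hc, mul_left_comm _ (c ^ (p - 1)), intervalIntegral.integral_const_mul]

/-- The flux is homogeneous of degree p - 1 and φ_{p'} of degree 1/(p-1), so their composition has
degree 1. -/
lemma IsMildSolution.smul (h : IsMildSolution n m p μ u) (hp : 1 < p) {c : ℝ} (hc : 0 < c) :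
    IsMildSolution n m p μ fun r => c * u r := by
  refine ⟨by have := h.continuous; fun_prop, fun r hr => ?_⟩
  have : ∀ t, phi (p / (p - 1)) (flux n m p μ (fun r => c * u r) t)
      = c * phi (p / (p - 1)) (flux n m p μ u t) := fun t => by
    rw [flux_smul hc, phi_mul (Real.rpow_pos_of_pos hc _), conj_sub_one hp,
      Real.rpow_rpow_inv hc.le (by linarith)]
  simp only [this, intervalIntegral.integral_const_mul]
  rw [h.eqn r hr]
  ring

end Flux

/-! ### Compactness of bounded families of solutions. -/

section Compactness

variable {n : ℕ} {m : ℝ → ℝ}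

lemma abs_flux_le {p μ P B M t : ℝ} {u : ℝ → ℝ} (hp : 1 < p) (hP : p ≤ P) (hμ : |μ| ≤ B)
    (hM : ∀ r ∈ Icc (0 : ℝ) 1, |m r| ≤ M) (hu : ∀ r ∈ Icc (0 : ℝ) 1, |u r| ≤ 1)
    (ht : t ∈ Icc (0 : ℝ) 1) : |flux n m p μ u t| ≤ B * (M * 2 ^ P) := by
  have hM0 : 0 ≤ M := (abs_nonneg _).trans (hM 0 (by simp))
  have hI : ‖∫ σ in (0 : ℝ)..1, σ ^ n * m (t * σ) * phi p (u (t * σ))‖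
      ≤ M * 2 ^ P * |(1 : ℝ) - 0| := by
    refine intervalIntegral.norm_integral_le_of_norm_le_const fun σ hσ => ?_
    rw [uIoc_of_le zero_le_one] at hσ
    have hs : t * σ ∈ Icc (0 : ℝ) 1 :=
      ⟨mul_nonneg ht.1 hσ.1.le, mul_le_one₀ ht.2 hσ.1.le hσ.2⟩
    have h1 : |σ ^ n| ≤ 1 := by
      rw [abs_of_nonneg (pow_nonneg hσ.1.le n)]; exact pow_le_one₀ hσ.1.le hσ.2
    have h2 := abs_phi_le hp hP (hu _ hs)
    rw [one_add_one_eq_two] at h2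
    rw [Real.norm_eq_abs, abs_mul, abs_mul]
    calc |σ ^ n| * |m (t * σ)| * |phi p (u (t * σ))| ≤ 1 * M * 2 ^ P := by
          gcongr; exact hM _ hs
      _ = M * 2 ^ P := by ring
  rw [sub_zero, abs_one, mul_one, Real.norm_eq_abs] at hI
  rw [flux, abs_mul, abs_mul, abs_of_nonneg ht.1]
  have : 0 ≤ M * 2 ^ P := by positivity
  have hB : 0 ≤ B := (abs_nonneg _).trans hμ
  calc |μ| * t * _ ≤ B * 1 * (M * 2 ^ P) := by
        gcongr
        · exact ht.1
        · exact ht.2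
    _ = _ := by ring

lemma tendsto_flux (hm : Continuous m) {p μ : ℕ → ℝ} {u : ℕ → ℝ → ℝ} {v : ℝ → ℝ} {p₀ μ₀ t : ℝ}
    (hp₀ : 1 < p₀) (hp : ∀ k, 1 < p k) (hpt : Tendsto p atTop (𝓝 p₀))
    (hμt : Tendsto μ atTop (𝓝 μ₀)) (huc : ∀ k, Continuous (u k))
    (hu : ∀ k, ∀ r ∈ Icc (0 : ℝ) 1, |u k r| ≤ 1)
    (hut : ∀ r ∈ Icc (0 : ℝ) 1, Tendsto (fun k => u k r) atTop (𝓝 (v r)))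
    (ht : t ∈ Icc (0 : ℝ) 1) :
    Tendsto (fun k => flux n m (p k) (μ k) (u k) t) atTop (𝓝 (flux n m p₀ μ₀ v t)) := by
  obtain ⟨P, hP⟩ := hpt.bddAbove_range
  refine (hμt.mul_const t).mul ?_
  have hs : ∀ σ ∈ uIoc (0 : ℝ) 1, t * σ ∈ Icc (0 : ℝ) 1 := fun σ hσ => by
    rw [uIoc_of_le zero_le_one] at hσ
    exact ⟨mul_nonneg ht.1 hσ.1.le, mul_le_one₀ ht.2 hσ.1.le hσ.2⟩
  apply intervalIntegral.tendsto_integral_filter_of_dominated_convergence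
    (fun σ => |σ ^ n * m (t * σ)| * (1 + 1) ^ P)
  · refine Eventually.of_forall fun k => Continuous.aestronglyMeasurable ?_
    have := continuous_phi (hp k)
    have := huc k
    fun_prop
  · refine Eventually.of_forall fun k => Eventually.of_forall fun σ hσ => ?_
    rw [Real.norm_eq_abs, abs_mul]
    exact mul_le_mul_of_nonneg_left
      (abs_phi_le (hp k) (hP ⟨k, rfl⟩) (hu k _ (hs σ hσ))) (abs_nonneg _)
  · exact Continuous.intervalIntegrable (by fun_prop) _ _
  · exact Eventually.of_forall fun σ hσ =>
      (tendsto_phi hp₀ hpt (hut _ (hs σ hσ))).const_mul _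

/-- Bounded families of solutions are compact, jointly in the exponent and the parameter. -/
theorem exists_subseq_tendsto_isMildSolution (hm : Continuous m) {p μ : ℕ → ℝ} {u : ℕ → ℝ → ℝ}
    {p₀ μ₀ : ℝ} (hp₀ : 1 < p₀) (hp : ∀ k, 1 < p k) (hpt : Tendsto p atTop (𝓝 p₀))
    (hμt : Tendsto μ atTop (𝓝 μ₀)) (hsol : ∀ k, IsMildSolution n m (p k) (μ k) (u k))
    (hu : ∀ k, ∀ r ∈ Icc (0 : ℝ) 1, |u k r| ≤ 1) :
    ∃ v, IsMildSolution n m p₀ μ₀ v ∧ ∃ φ : ℕ → ℕ, StrictMono φ ∧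
      TendstoUniformlyOn (fun k => u (φ k)) v atTop (Icc 0 1) := by
  have hqt : Tendsto (fun k => p k / (p k - 1)) atTop (𝓝 (p₀ / (p₀ - 1))) :=
    hpt.div (hpt.sub_const 1) (by linarith)
  obtain ⟨P, hP⟩ := hpt.bddAbove_range
  obtain ⟨Q, hQ⟩ := hqt.bddAbove_range
  obtain ⟨B, hB⟩ := hμt.abs.bddAbove_range
  obtain ⟨M, hM⟩ := isCompact_Icc.exists_bound_of_continuousOn
    (hm.continuousOn (s := Icc (0 : ℝ) 1))
  set L : ℝ := (1 + B * (M * 2 ^ P)) ^ Q with hL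
  have hbound : ∀ k, ∀ t ∈ Icc (0 : ℝ) 1,
      |phi (p k / (p k - 1)) (flux n m (p k) (μ k) (u k) t)| ≤ L := fun k t ht =>
    abs_phi_le (one_lt_conj (hp k)) (hQ ⟨k, rfl⟩)
      (abs_flux_le (hp k) (hP ⟨k, rfl⟩) (hB ⟨k, rfl⟩) hM (hu k) ht)
  have hcont : ∀ k, Continuous fun t =>
      phi (p k / (p k - 1)) (flux n m (p k) (μ k) (u k) t) := fun k =>
    (continuous_phi (one_lt_conj (hp k))).comp (continuous_flux hm (hp k) (hsol k).continuous)
  -- The derivatives are bounded by L for all k, which gives the equicontinuity needed for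
  -- Arzelà–Ascoli.
  have hlip : ∀ k, ∀ r ∈ Icc (0 : ℝ) 1, ∀ s ∈ Icc (0 : ℝ) 1, |u k r - u k s| ≤ L * |r - s| := by
    intro k r hr s hs
    rw [(hsol k).eqn r hr, (hsol k).eqn s hs, sub_sub_sub_cancel_left,
      intervalIntegral.integral_interval_sub_left ((hcont k).intervalIntegrable _ _)
        ((hcont k).intervalIntegrable _ _), abs_sub_comm r s, ← Real.norm_eq_abs]
    refine intervalIntegral.norm_integral_le_of_norm_le_const fun t ht => hbound k t ?_
    exact (convex_Icc (0 : ℝ) 1).ordConnected.uIcc_subset hr hs (uIoc_subset_uIcc ht)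
  let f : ℕ → BoundedContinuousFunction (Icc (0 : ℝ) 1) ℝ := fun k =>
    BoundedContinuousFunction.mkOfCompact
      ⟨fun x => u k x, (hsol k).continuous.comp continuous_subtype_val⟩
  have hcomp : IsCompact (closure (range f)) := by
    refine BoundedContinuousFunction.arzela_ascoli (Icc (-1) 1) isCompact_Icc _ ?_ ?_
    · rintro _ x ⟨k, rfl⟩
      exact abs_le.1 (hu k x x.2)
    · refine Metric.equicontinuous_of_continuity_modulus (fun x => L * x) ?_ _ ?_
      · exact Continuous.tendsto' (by fun_prop) _ _ (by simp)
      · rintro x y ⟨_, k, rfl⟩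
        exact hlip k x x.2 y y.2
  obtain ⟨g, -, φ, hφ, hg⟩ := hcomp.tendsto_subseq (x := f) fun k => subset_closure ⟨k, rfl⟩
  have hunif : TendstoUniformlyOn (fun k => u (φ k)) (IccExtend zero_le_one g) atTop
      (Icc 0 1) := by
    rw [BoundedContinuousFunction.tendsto_iff_tendstoUniformly, Metric.tendstoUniformly_iff] at hg
    rw [Metric.tendstoUniformlyOn_iff]
    intro ε hε
    filter_upwards [hg ε hε] with k hk x hx
    rw [IccExtend_of_mem _ _ hx]
    exact hk ⟨x, hx⟩
  refine ⟨IccExtend zero_le_one g, ⟨g.continuous.Icc_extend', fun r hr => ?_⟩, φ, hφ, hunif⟩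
  have hpw : ∀ r ∈ Icc (0 : ℝ) 1,
      Tendsto (fun k => u (φ k) r) atTop (𝓝 (IccExtend zero_le_one g r)) :=
    fun r hr => hunif.tendsto_at hr
  have hsub := hφ.tendsto_atTop
  have hint : Tendsto (fun k => ∫ t in (0 : ℝ)..r, phi (p (φ k) / (p (φ k) - 1))
      (flux n m (p (φ k)) (μ (φ k)) (u (φ k)) t)) atTop
      (𝓝 (∫ t in (0 : ℝ)..r, phi (p₀ / (p₀ - 1))
        (flux n m p₀ μ₀ (IccExtend zero_le_one g) t))) := by
    have hmem : ∀ t ∈ uIoc (0 : ℝ) r, t ∈ Icc (0 : ℝ) 1 := fun t ht => by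
      rw [uIoc_of_le hr.1] at ht
      exact ⟨ht.1.le, ht.2.trans hr.2⟩
    apply intervalIntegral.tendsto_integral_filter_of_dominated_convergence (fun _ => L)
    · exact Eventually.of_forall fun k => (hcont _).aestronglyMeasurable
    · exact Eventually.of_forall fun k => Eventually.of_forall fun t ht => hbound _ t (hmem t ht)
    · exact intervalIntegrable_const
    · exact Eventually.of_forall fun t ht => tendsto_phi (one_lt_conj hp₀) (hqt.comp hsub)
        (tendsto_flux hm hp₀ (fun k => hp (φ k)) (hpt.comp hsub) (hμt.comp hsub)
          (fun k => (hsol (φ k)).continuous) (fun k => hu (φ k)) hpw (hmem t ht))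
  refine tendsto_nhds_unique (hpw r hr) ?_
  refine ((hpw 0 (by simp)).sub hint).congr fun k => ?_
  exact ((hsol (φ k)).eqn r hr).symm

end Compactness

/-! ### Uniqueness for zero Cauchy data and the strong maximum principle. -/

section StrongMaximum

variable {n : ℕ} {m : ℝ → ℝ} {p μ : ℝ} {u : ℝ → ℝ}

/-- Uniqueness for zero Cauchy data, locally. -/
lemma IsMildSolution.eq_zero_near (h : IsMildSolution n m p μ u) (hm : Continuous m) (hp : 1 < p)
    {r₀ : ℝ} (hr₀ : r₀ ∈ Icc (0 : ℝ) 1) (hu : u r₀ = 0) (hf : flux n m p μ u r₀ = 0) :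
    ∃ δ > 0, ∀ r ∈ Icc (0 : ℝ) 1, |r - r₀| < δ → u r = 0 := by
  have hq := one_lt_conj hp
  set q := p / (p - 1) with hqdef
  obtain ⟨M, hM⟩ := isCompact_Icc.exists_bound_of_continuousOn
    (hm.continuousOn (s := Icc (0 : ℝ) 1))
  have hM0 : 0 ≤ M := (norm_nonneg _).trans (hM 0 (by simp))
  set C : ℝ := |μ| * M * 2 ^ n with hC
  have hC0 : 0 ≤ C := by positivity
  set K : ℝ := C ^ (q - 1) with hK
  have hK0 : 0 ≤ K := Real.rpow_nonneg hC0 _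
  -- The last condition keeps s^n / t^n ≤ 2^n for s between r₀ and t, so dividing by t^n is
  -- harmless. It is automatic at r₀ = 0; otherwise δ ≤ r₀/2 suffices.
  obtain ⟨δ, hδ, hδ1, hδK, hδr⟩ : ∃ δ > 0, δ ≤ 1 ∧ δ * K ≤ 1 / 2 ∧
      ∀ t, 0 ≤ t → |t - r₀| ≤ δ → max t r₀ ≤ 2 * t := by
    have hρ : 0 < if r₀ = 0 then (1 : ℝ) else r₀ / 2 := by
      split_ifs with h0
      · exact one_pos
      · have := lt_of_le_of_ne hr₀.1 (Ne.symm h0); linarith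
    refine ⟨min (min 1 (1 / (2 * (K + 1)))) (if r₀ = 0 then (1 : ℝ) else r₀ / 2),
      by positivity, (min_le_left _ _).trans (min_le_left _ _), ?_, ?_⟩
    · calc _ ≤ 1 / (2 * (K + 1)) * K := by
            gcongr; exact (min_le_left _ _).trans (min_le_right _ _)
        _ ≤ 1 / 2 := by
            rw [div_mul_eq_mul_div, div_le_div_iff₀ (by positivity) (by norm_num)]
            linarith
    · intro t ht htr
      have htr := htr.trans (min_le_right _ _)
      split_ifs at htr with h0
      · rw [h0, max_eq_left ht]; linarith
      · have := (abs_le.1 htr).1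
        exact max_le (by linarith) (by linarith)
  have hJ : IsCompact (Icc (0 : ℝ) 1 ∩ Icc (r₀ - δ) (r₀ + δ)) := isCompact_Icc.inter isCompact_Icc
  have hr₀J : r₀ ∈ Icc (0 : ℝ) 1 ∩ Icc (r₀ - δ) (r₀ + δ) :=
    ⟨hr₀, by constructor <;> linarith⟩
  obtain ⟨r₁, hr₁, hmax⟩ := hJ.exists_isMaxOn ⟨r₀, hr₀J⟩ h.continuous.abs.continuousOn
  have hA : ∀ t ∈ Icc (0 : ℝ) 1 ∩ Icc (r₀ - δ) (r₀ + δ), |u t| ≤ |u r₁| := fun t ht => hmax ht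
  set A := |u r₁| with hAdef
  have hA0 : 0 ≤ A := abs_nonneg _
  have hord : (Icc (0 : ℝ) 1 ∩ Icc (r₀ - δ) (r₀ + δ)).OrdConnected :=
    ordConnected_Icc.inter ordConnected_Icc
  have hflux : ∀ t ∈ Icc (0 : ℝ) 1 ∩ Icc (r₀ - δ) (r₀ + δ),
      |flux n m p μ u t| ≤ C * A ^ (p - 1) := by
    intro t ht
    rcases eq_or_lt_of_le ht.1.1 with h0 | h0
    · rw [← h0, flux_zero, abs_zero]; positivity
    have htr : |t - r₀| ≤ δ := abs_le.2 ⟨by linarith [ht.2.1], by linarith [ht.2.2]⟩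
    have hc : Continuous fun s => μ * m s * s ^ n * phi p (u s) := by
      have := continuous_phi hp
      have := h.continuous
      fun_prop
    have e : t ^ n * flux n m p μ u t = ∫ s in r₀..t, μ * m s * s ^ n * phi p (u s) := by
      have e1 := pow_mul_flux (n := n) (m := m) (p := p) (μ := μ) (u := u) t
      have e2 := pow_mul_flux (n := n) (m := m) (p := p) (μ := μ) (u := u) r₀
      rw [hf, mul_zero] at e2
      rw [← intervalIntegral.integral_interval_sub_left (hc.intervalIntegrable 0 t)
        (hc.intervalIntegrable 0 r₀), ← e1, ← e2, sub_zero]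
    have hb : ‖∫ s in r₀..t, μ * m s * s ^ n * phi p (u s)‖
        ≤ |μ| * M * (2 * t) ^ n * A ^ (p - 1) * |t - r₀| := by
      refine intervalIntegral.norm_integral_le_of_norm_le_const fun s hs => ?_
      have hs' := uIoc_subset_uIcc hs
      have hsJ := hord.uIcc_subset hr₀J ht hs'
      have hs2 : s ≤ 2 * t := by
        refine le_trans ?_ (hδr t ht.1.1 htr)
        rw [max_comm]
        exact hs'.2
      rw [Real.norm_eq_abs, abs_mul, abs_mul, abs_mul, abs_phi hp, abs_pow,
        abs_of_nonneg hsJ.1.1]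
      have : |m s| ≤ M := hM s hsJ.1
      have := hA s hsJ
      have := hsJ.1.1
      gcongr
    rw [← e, Real.norm_eq_abs, abs_mul, abs_of_pos (pow_pos h0 n)] at hb
    have h1 : t ^ n * |flux n m p μ u t| ≤ t ^ n * (C * A ^ (p - 1)) := by
      refine hb.trans ?_
      calc _ ≤ |μ| * M * (2 * t) ^ n * A ^ (p - 1) * 1 := by
            gcongr; exact htr.trans hδ1
        _ = t ^ n * (C * A ^ (p - 1)) := by rw [hC, mul_pow]; ring
    exact le_of_mul_le_mul_left h1 (pow_pos h0 n)
  -- Although φ_p and φ_{p'} need not be Lipschitz, their degrees p - 1 and 1/(p-1) cancel, so the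
  -- bound is linear in A. Integrating it over length at most δ yields A ≤ A/2.
  have hphi : ∀ t ∈ Icc (0 : ℝ) 1 ∩ Icc (r₀ - δ) (r₀ + δ),
      |phi q (flux n m p μ u t)| ≤ K * A := by
    intro t ht
    rw [abs_phi hq]
    calc _ ≤ (C * A ^ (p - 1)) ^ (q - 1) :=
          Real.rpow_le_rpow (abs_nonneg _) (hflux t ht) (by linarith)
      _ = K * A := by
          rw [Real.mul_rpow hC0 (by positivity), hqdef, conj_sub_one hp,
            Real.rpow_rpow_inv hA0 (by linarith), hK, hqdef, conj_sub_one hp]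
  have hcq : Continuous fun t => phi q (flux n m p μ u t) :=
    (continuous_phi hq).comp (continuous_flux hm hp h.continuous)
  have hA_le : A ≤ K * A * |r₁ - r₀| := by
    have e : u r₁ = -∫ t in r₀..r₁, phi q (flux n m p μ u t) := by
      have e1 := h.eqn r₁ hr₁.1
      have e2 := h.eqn r₀ hr₀
      rw [← intervalIntegral.integral_interval_sub_left (hcq.intervalIntegrable 0 r₁)
        (hcq.intervalIntegrable 0 r₀)]
      rw [hu] at e2
      linarith
    have hb : ‖∫ t in r₀..r₁, phi q (flux n m p μ u t)‖ ≤ K * A * |r₁ - r₀| :=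
      intervalIntegral.norm_integral_le_of_norm_le_const fun t ht =>
        hphi t (hord.uIcc_subset hr₀J hr₁ (uIoc_subset_uIcc ht))
    rwa [← norm_neg, ← e] at hb
  have hAz : A = 0 := by
    have : |r₁ - r₀| ≤ δ := abs_le.2 ⟨by linarith [hr₁.2.1], by linarith [hr₁.2.2]⟩
    have h2 : K * A * |r₁ - r₀| ≤ δ * K * A := by
      calc _ ≤ K * A * δ := by gcongr
        _ = _ := by ring
    have h3 : δ * K * A ≤ 1 / 2 * A := by gcongr
    linarith
  refine ⟨δ, hδ, fun r hr hrδ => ?_⟩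
  have := abs_lt.1 hrδ
  have := hA r ⟨hr, by constructor <;> linarith⟩
  rw [hAz] at this
  exact abs_nonpos_iff.1 this

/-- Strong maximum principle. -/
theorem IsMildSolution.eq_zero_of_nonneg (h : IsMildSolution n m p μ u) (hm : Continuous m)
    (hp : 1 < p) (hu : ∀ r ∈ Icc (0 : ℝ) 1, 0 ≤ u r) {r₀ : ℝ} (hr₀ : r₀ ∈ Ico (0 : ℝ) 1)
    (h₀ : u r₀ = 0) : ∀ r ∈ Icc (0 : ℝ) 1, u r = 0 := by
  have hnear : ∀ s ∈ Ico (0 : ℝ) 1, u s = 0 →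
      ∃ δ > 0, ∀ r ∈ Icc (0 : ℝ) 1, |r - s| < δ → u r = 0 := by
    intro s hs hus
    refine h.eq_zero_near hm hp (Ico_subset_Icc_self hs) hus ?_
    rcases eq_or_lt_of_le hs.1 with h0 | h0
    · rw [← h0, flux_zero]
    -- An interior zero of a nonnegative function is a minimum, so u' and hence the flux vanish
    -- there.
    · have hmin : IsLocalMin u s := by
        filter_upwards [Icc_mem_nhds h0 hs.2] with x hx
        rw [hus]
        exact hu x hx
      have := hmin.hasDerivAt_eq_zero (h.hasDerivAt hm hp ⟨h0, hs.2⟩)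
      rw [← phi_phi_conj hp (flux n m p μ u s), neg_eq_zero.1 this, phi_zero]
  choose! δ hδ hδ' using hnear
  have hzero : EqOn u 0 (Ico 0 1) := by
    by_contra hne
    simp only [EqOn, not_forall] at hne
    obtain ⟨r, hr, hur⟩ := hne
    -- Connectedness of [0,1): the balls around the zeros and the nonvanishing set are open, cover
    -- it, and are disjoint inside it.
    obtain ⟨x, hx, hx1, hx2⟩ := isPreconnected_Ico (a := (0 : ℝ)) (b := 1)
      (⋃ s ∈ {s | s ∈ Ico (0 : ℝ) 1 ∧ u s = 0}, Metric.ball s (δ s)) {x | u x ≠ 0}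
      (isOpen_biUnion fun _ _ => Metric.isOpen_ball)
      (isOpen_ne_fun h.continuous continuous_const)
      (fun x hx => by
        by_cases hux : u x = 0
        · exact Or.inl (mem_biUnion (show x ∈ {s | s ∈ Ico (0 : ℝ) 1 ∧ u s = 0} from ⟨hx, hux⟩)
            (Metric.mem_ball_self (hδ x hx hux)))
        · exact Or.inr hux)
      ⟨r₀, hr₀, mem_biUnion (show r₀ ∈ {s | s ∈ Ico (0 : ℝ) 1 ∧ u s = 0} from ⟨hr₀, h₀⟩)
        (Metric.mem_ball_self (hδ r₀ hr₀ h₀))⟩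
      ⟨r, hr, hur⟩
    simp only [mem_iUnion] at hx1
    obtain ⟨s, ⟨hs, hus⟩, hxs⟩ := hx1
    exact hx2 (hδ' s hs hus x (Ico_subset_Icc_self hx) hxs)
  have := hzero.closure h.continuous continuous_const
  rwa [closure_Ico zero_ne_one] at this

end StrongMaximum

/-! ### The Riccati equation for w = t^n φ_p(u'/u), and its truncation. -/

section Riccati

variable {n : ℕ} {m : ℝ → ℝ} {p μ : ℝ} {u : ℝ → ℝ}

lemma IsMildSolution.of_hasDerivAt (hm : Continuous m) (hp : 1 < p) (hu : Continuous u)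
    (h : ∀ r ∈ Ioo (0 : ℝ) 1, HasDerivAt u (-phi (p / (p - 1)) (flux n m p μ u r)) r) :
    IsMildSolution n m p μ u := by
  refine ⟨hu, fun r hr => ?_⟩
  have hc : Continuous fun t => phi (p / (p - 1)) (flux n m p μ u t) :=
    (continuous_phi (one_lt_conj hp)).comp (continuous_flux hm hp hu)
  have := intervalIntegral.integral_eq_sub_of_hasDerivAt_of_le hr.1 hu.continuousOn
    (fun x hx => h x ⟨hx.1, hx.2.trans_le hr.2⟩) (hc.neg.intervalIntegrable 0 r)
  rw [intervalIntegral.integral_neg] at this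
  linarith

/-- A positive solution produces a solution of the Riccati equation. -/
lemma IsMildSolution.riccati (h : IsMildSolution n m p μ u) (hm : Continuous m) (hp : 1 < p)
    (hpos : ∀ r ∈ Icc (0 : ℝ) 1, 0 < u r) {t : ℝ} (ht : t ∈ Icc (0 : ℝ) 1) :
    HasDerivWithinAt (fun t => -(t ^ n * flux n m p μ u t) * u t ^ (1 - p))
      (-(μ * m t * t ^ n)
        - (p - 1) * t ^ n * |-flux n m p μ u t * u t ^ (1 - p)| ^ (p / (p - 1))) (Icc 0 1) t := by
  have hut := hpos t ht
  have hq := one_lt_conj hp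
  have h1 := (hasDerivAt_pow_mul_flux (n := n) (μ := μ) hm hp h.continuous t).neg.hasDerivWithinAt
    (s := Icc (0 : ℝ) 1)
  have h2 := (h.hasDerivWithinAt hm hp ht).rpow_const (p := 1 - p) (Or.inl hut.ne')
  convert! h1.mul h2 using 1
  set F := flux n m p μ u t
  have e1 : phi p (u t) * u t ^ (1 - p) = 1 := by
    rw [phi_of_pos hut, ← Real.rpow_add hut]; simp
  have e2 : |-F * u t ^ (1 - p)| ^ (p / (p - 1)) = |F| ^ (p / (p - 1)) * u t ^ (-p) := by
    rw [abs_mul, abs_neg, abs_of_pos (Real.rpow_pos_of_pos hut _),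
      Real.mul_rpow (abs_nonneg _) (Real.rpow_nonneg hut.le _), ← Real.rpow_mul hut.le]
    congr 2
    have : p - 1 ≠ 0 := by linarith
    field_simp
    ring
  have e3 : (-fun t => t ^ n * flux n m p μ u t) t = -(t ^ n * F) := rfl
  rw [e2, e3, ← phi_mul_self hq, show 1 - p - 1 = -p by ring]
  linear_combination (-(μ * m t * t ^ n)) * (-e1)

/-- The truncated power nonlinearity of the Riccati equation. -/
noncomputable def truncPow (q K z : ℝ) : ℝ := (min |z| K) ^ q

lemma truncPow_of_le {q K z : ℝ} (h : |z| ≤ K) : truncPow q K z = |z| ^ q := by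
  rw [truncPow, min_eq_left h]

lemma abs_truncPow_le {q K : ℝ} (hq : 1 < q) (hK : 0 ≤ K) (z : ℝ) : |truncPow q K z| ≤ K ^ q := by
  have h0 : 0 ≤ min |z| K := le_min (abs_nonneg _) hK
  rw [truncPow, abs_of_nonneg (Real.rpow_nonneg h0 _)]
  exact Real.rpow_le_rpow h0 (min_le_right _ _) (by linarith)

lemma truncPow_lipschitz {q K : ℝ} (hq : 1 < q) (hK : 0 ≤ K) (x y : ℝ) :
    |truncPow q K x - truncPow q K y| ≤ q * K ^ (q - 1) * |x - y| := by
  have h1 : ‖min |x| K ^ q - min |y| K ^ q‖ ≤ q * K ^ (q - 1) * ‖min |x| K - min |y| K‖ := by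
    refine (convex_Icc (0 : ℝ) K).norm_image_sub_le_of_norm_hasDerivWithin_le
      (f := fun z => z ^ q) (f' := fun z => q * z ^ (q - 1))
      (fun z _ => (Real.hasDerivAt_rpow_const (Or.inr hq.le)).hasDerivWithinAt) (fun z hz => ?_)
      ⟨le_min (abs_nonneg _) hK, min_le_right _ _⟩ ⟨le_min (abs_nonneg _) hK, min_le_right _ _⟩
    rw [Real.norm_eq_abs, abs_of_nonneg (mul_nonneg (by linarith) (Real.rpow_nonneg hz.1 _))]
    have := hz.1
    have := hz.2
    gcongr
  refine h1.trans (mul_le_mul_of_nonneg_left ?_ (by positivity))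
  calc ‖min |x| K - min |y| K‖ ≤ max |(|x| - |y|)| |K - K| := abs_min_sub_min_le_max _ _ _ _
    _ ≤ |x - y| := by
      rw [sub_self, abs_zero]
      exact max_le (abs_abs_sub_abs_le _ _) (abs_nonneg _)

lemma continuous_truncPow {q K : ℝ} (hq : 1 < q) : Continuous (truncPow q K) :=
  Continuous.rpow_const (by fun_prop) fun _ => Or.inr (by linarith)

/-- With s = t^n this is the singular term of the Riccati field; boundedness of the truncated power
makes it tend to 0 as s does. -/
lemma continuous_mul_truncPow_div {q K : ℝ} (hq : 1 < q) (hK : 0 ≤ K) (w : ℝ) :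
    Continuous fun s => s * truncPow q K (w / s) := by
  rw [continuous_iff_continuousAt]
  intro s
  rcases eq_or_ne s 0 with rfl | hs
  · rw [ContinuousAt, zero_mul]
    refine squeeze_zero_norm (a := fun s => |s| * K ^ q) (fun s => ?_) ?_
    · rw [Real.norm_eq_abs, abs_mul]
      exact mul_le_mul_of_nonneg_left (abs_truncPow_le hq hK _) (abs_nonneg _)
    · exact Continuous.tendsto' (by fun_prop) _ _ (by simp)
  · have h1 : ContinuousAt (fun s => w / s) s := continuousAt_const.div continuousAt_id hs
    exact continuousAt_id.mul ((continuous_truncPow hq).continuousAt.comp h1)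

/-- The Riccati vector field, with truncated nonlinearity. -/
noncomputable def riccatiField (n : ℕ) (m : ℝ → ℝ) (p K μ t w : ℝ) : ℝ :=
  -(μ * m t * t ^ n) - (p - 1) * (t ^ n * truncPow (p / (p - 1)) K (w / t ^ n))

/-- The outer factor t^n cancels the 1/t^n inside, so the constant does not depend on t. The added 1
makes it evidently positive for Grönwall. -/
lemma riccatiField_lipschitz (hp : 1 < p) {K : ℝ} (hK : 0 ≤ K) (t : ℝ) :
    LipschitzWith
      (((p - 1) * (p / (p - 1) * K ^ (p / (p - 1) - 1)) + 1).toNNReal)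
      (riccatiField n m p K μ t) := by
  have hq := one_lt_conj hp
  set q := p / (p - 1)
  have hL : 0 ≤ (p - 1) * (q * K ^ (q - 1)) :=
    mul_nonneg (by linarith) (mul_nonneg (by linarith) (Real.rpow_nonneg hK _))
  refine LipschitzWith.of_dist_le' (K := (p - 1) * (q * K ^ (q - 1)) + 1) fun x y => ?_
  rw [Real.dist_eq, Real.dist_eq, riccatiField, riccatiField, sub_sub_sub_cancel_left, ← mul_sub,
    ← mul_sub, abs_mul, abs_mul, abs_of_pos (by linarith : 0 < p - 1), abs_sub_comm]
  rcases eq_or_ne (t ^ n) 0 with h0 | h0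
  · rw [h0]; simp only [abs_zero, zero_mul, mul_zero]; positivity
  · have := truncPow_lipschitz hq hK (x / t ^ n) (y / t ^ n)
    rw [← sub_div, abs_div] at this
    have h0' := abs_pos.2 h0
    calc _ ≤ (p - 1) * (|t ^ n| * (q * K ^ (q - 1) * (|x - y| / |t ^ n|))) := by
          have : 0 ≤ p - 1 := by linarith
          gcongr
      _ = (p - 1) * (q * K ^ (q - 1)) * |x - y| := by field_simp
      _ ≤ _ := by gcongr; linarith

lemma abs_riccatiField_le (hp : 1 < p) {K M t : ℝ} (hK : 0 ≤ K) (ht : 0 ≤ t)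
    (hM : |m t| ≤ M) (w : ℝ) :
    |riccatiField n m p K μ t w| ≤ (|μ| * M + (p - 1) * K ^ (p / (p - 1))) * t ^ n := by
  rw [riccatiField]
  refine (abs_sub _ _).trans ?_
  rw [abs_neg, abs_mul, abs_mul, abs_mul, abs_mul, abs_of_pos (by linarith : 0 < p - 1),
    abs_of_nonneg (pow_nonneg ht n)]
  have := abs_truncPow_le (one_lt_conj hp) hK (w / t ^ n)
  have h1 : 0 ≤ p - 1 := by linarith
  calc _ ≤ |μ| * M * t ^ n + (p - 1) * (t ^ n * K ^ (p / (p - 1))) := by gcongr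
    _ = _ := by ring

/-- Truncation makes the field bounded and globally Lipschitz in w, so Picard–Lindelöf reaches all
of [0,1] in a ball whose radius is the bound itself. -/
lemma exists_riccati_trunc (hm : Continuous m) (hp : 1 < p) {K : ℝ} (hK : 0 ≤ K) :
    ∃ w : ℝ → ℝ, w 0 = 0 ∧ ∀ t ∈ Icc (0 : ℝ) 1,
      HasDerivWithinAt w (riccatiField n m p K μ t (w t)) (Icc 0 1) t := by
  obtain ⟨M, hM⟩ := isCompact_Icc.exists_bound_of_continuousOn
    (hm.continuousOn (s := Icc (0 : ℝ) 1))
  have hM0 : 0 ≤ M := (norm_nonneg _).trans (hM 0 (by simp))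
  have hp1 : 0 ≤ p - 1 := by linarith
  set L : ℝ := |μ| * M + (p - 1) * K ^ (p / (p - 1)) with hL
  have hL0 : 0 ≤ L := by positivity
  have hPL : IsPicardLindelof (riccatiField n m p K μ) (tmin := 0) (tmax := 1)
      ⟨0, by simp⟩ 0 L.toNNReal 0 L.toNNReal
      (((p - 1) * (p / (p - 1) * K ^ (p / (p - 1) - 1)) + 1).toNNReal) := by
    refine ⟨fun t _ => (riccatiField_lipschitz hp hK t).lipschitzOnWith, fun x _ => ?_,
      fun t ht x _ => ?_, by simp⟩
    · have := (continuous_mul_truncPow_div (one_lt_conj hp) hK x).comp (continuous_pow n)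
      simp only [Function.comp_def] at this
      unfold riccatiField
      fun_prop
    · rw [Real.coe_toNNReal _ hL0]
      refine (abs_riccatiField_le hp hK ht.1 (hM t ht) x).trans ?_
      exact mul_le_of_le_one_right hL0 (pow_le_one₀ ht.1 ht.2)
  obtain ⟨w, hw0, hw⟩ := hPL.exists_eq_forall_mem_Icc_hasDerivWithinAt₀
  exact ⟨w, hw0, hw⟩

end Riccati

/-! ### Persistence of positive solutions under a change of parameter. -/

section Openness

variable {n : ℕ} {m : ℝ → ℝ} {p μ : ℝ} {u : ℝ → ℝ}

/-- A bounded solution of the Riccati equation produces a positive solution. -/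
lemma exists_pos_isMildSolution_of_riccati (hm : Continuous m) (hp : 1 < p) {K : ℝ} (hK : 0 ≤ K)
    {w : ℝ → ℝ} (hw0 : w 0 = 0) (hw : ∀ t ∈ Icc (0 : ℝ) 1,
      HasDerivWithinAt w (riccatiField n m p K μ t (w t)) (Icc 0 1) t)
    (hwK : ∀ t ∈ Ioc (0 : ℝ) 1, |w t / t ^ n| ≤ K) :
    ∃ u, IsMildSolution n m p μ u ∧ ∀ r ∈ Icc (0 : ℝ) 1, 0 < u r := by
  have hq := one_lt_conj hp
  have hp1 : 0 ≤ p - 1 := by linarith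
  obtain ⟨M, hM⟩ := isCompact_Icc.exists_bound_of_continuousOn
    (hm.continuousOn (s := Icc (0 : ℝ) 1))
  have hM0 : 0 ≤ M := (norm_nonneg _).trans (hM 0 (by simp))
  set C : ℝ := |μ| * M + (p - 1) * K ^ (p / (p - 1)) with hC
  have hC0 : 0 ≤ C := by positivity
  have hwc : ContinuousOn w (Icc 0 1) := fun t ht => (hw t ht).continuousWithinAt
  -- The field is at most C t^n on [0,t], so |w t| ≤ C t^(n+1); hence w / t^n extends continuously
  -- by 0 at the origin.
  have hsmall : ∀ t ∈ Ioc (0 : ℝ) 1, |w t / t ^ n| ≤ C * t := by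
    intro t ht
    have hsub : Icc 0 t ⊆ Icc (0 : ℝ) 1 := Icc_subset_Icc_right ht.2
    have := (convex_Icc 0 t).norm_image_sub_le_of_norm_hasDerivWithin_le (C := C * t ^ n)
      (fun s hs => (hw s (hsub hs)).mono hsub)
      (fun s hs => (abs_riccatiField_le hp hK hs.1 (hM s (hsub hs)) _).trans (by
        have := hs.1
        have := hs.2
        gcongr))
      (left_mem_Icc.2 ht.1.le) (right_mem_Icc.2 ht.1.le)
    rw [hw0, sub_zero, sub_zero, Real.norm_eq_abs, Real.norm_eq_abs, abs_of_pos ht.1] at this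
    have htn := pow_pos ht.1 n
    rw [abs_div, abs_of_pos htn, div_le_iff₀ htn]
    linarith
  set z : ℝ → ℝ := fun t => w t / t ^ n with hz
  have hz0 : z 0 = 0 := by simp [hz, hw0]
  have hzc : ContinuousOn z (Icc 0 1) := by
    intro t ht
    rcases eq_or_lt_of_le ht.1 with h0 | h0
    · rw [← h0, ContinuousWithinAt, hz0]
      refine squeeze_zero_norm' (a := fun t => C * t) ?_ ?_
      · filter_upwards [self_mem_nhdsWithin] with s hs
        rcases eq_or_lt_of_le hs.1 with h1 | h1
        · simp [← h1, hz0]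
        · exact hsmall s ⟨h1, hs.2⟩
      · exact (Continuous.tendsto' (by fun_prop) _ _ (by simp)).mono_left nhdsWithin_le_nhds
    · exact (hwc t ht).div (continuous_pow n).continuousWithinAt (pow_pos h0 n).ne'
  set Z : ℝ → ℝ := IccExtend zero_le_one ((Icc (0 : ℝ) 1).domRestrict z) with hZ
  have hZc : Continuous Z := hzc.domRestrict.Icc_extend'
  have hZz : ∀ t ∈ Icc (0 : ℝ) 1, Z t = z t := fun t ht => by rw [hZ, IccExtend_of_mem _ _ ht]; rfl
  have hψ : Continuous fun t => phi (p / (p - 1)) (Z t) := (continuous_phi hq).comp hZc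
  -- This undoes the substitution Z = φ_p(u'/u).
  set u : ℝ → ℝ := fun r => Real.exp (∫ t in (0 : ℝ)..r, phi (p / (p - 1)) (Z t)) with hu
  have hupos : ∀ r, 0 < u r := fun r => Real.exp_pos _
  have hud : ∀ r, HasDerivAt u (u r * phi (p / (p - 1)) (Z r)) r := fun r =>
    (hψ.integral_hasStrictDerivAt 0 r).hasDerivAt.exp
  have huc : Continuous u := continuous_iff_continuousAt.2 fun r => (hud r).continuousAt
  have hφc := continuous_phi hp
  have hflux : ∀ t ∈ Icc (0 : ℝ) 1, flux n m p μ u t = -(u t ^ (p - 1) * Z t) := by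
    intro t ht
    rcases eq_or_lt_of_le ht.1 with h0 | h0
    · rw [← h0, flux_zero, hZz 0 (by simp), hz0, mul_zero, neg_zero]
    have htn := pow_pos h0 n
    have hsub : Icc 0 t ⊆ Icc (0 : ℝ) 1 := Icc_subset_Icc_right ht.2
    have hI := intervalIntegral.integral_eq_sub_of_hasDerivAt_of_le h0.le
      (f := fun s => w s * u s ^ (p - 1)) (f' := fun s => -(μ * m s * s ^ n * phi p (u s)))
      ((hwc.mono hsub).mul (huc.rpow_const fun s => Or.inl (hupos s).ne').continuousOn)
      (fun s hs => ?_) (Continuous.intervalIntegrable (by fun_prop) _ _)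
    · rw [intervalIntegral.integral_neg, ← pow_mul_flux, hw0, zero_mul, sub_zero] at hI
      have : t ^ n * flux n m p μ u t = t ^ n * -(u t ^ (p - 1) * Z t) := by
        rw [hZz t ht, hz]
        field_simp
        linarith
      exact mul_left_cancel₀ htn.ne' this
    · have hs1 : s ∈ Ioo (0 : ℝ) 1 := ⟨hs.1, hs.2.trans_le ht.2⟩
      have hsI := Ioo_subset_Icc_self hs1
      have hsn := pow_pos hs.1 n
      have h1 := (hw s hsI).hasDerivAt (Icc_mem_nhds hs1.1 hs1.2)
      have h2 := (hud s).rpow_const (p := p - 1) (Or.inl (hupos s).ne')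
      convert! h1.mul h2 using 1
      have hwz : w s = s ^ n * Z s := by rw [hZz s hsI, hz]; field_simp
      -- The truncation is inactive here, so its power term cancels the derivative of u^(p-1).
      have hZK : |Z s| ≤ K := by rw [hZz s hsI]; exact hwK s ⟨hs.1, hs1.2.le⟩
      have e : s ^ n * Z s / s ^ n = Z s := by field_simp
      rw [riccatiField, hwz, e, truncPow_of_le hZK, ← phi_mul_self hq, phi_of_pos (hupos s),
        Real.rpow_sub_one (hupos s).ne' (p - 1)]
      have := (hupos s).ne'
      field_simp
      ring
  refine ⟨u, .of_hasDerivAt hm hp huc fun r hr => ?_, fun r _ => hupos r⟩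
  rw [hflux r (Ioo_subset_Icc_self hr), phi_neg, neg_neg,
    phi_mul (Real.rpow_pos_of_pos (hupos r) _), conj_sub_one hp,
    Real.rpow_rpow_inv (hupos r).le (by linarith)]
  exact hud r

/-- Existence of a positive solution is an open condition on the parameter. -/
theorem IsMildSolution.exists_pos_near (h : IsMildSolution n m p μ u) (hm : Continuous m)
    (hp : 1 < p) (hpos : ∀ r ∈ Icc (0 : ℝ) 1, 0 < u r) :
    ∃ ε > 0, ∀ ν, |ν - μ| < ε →
      ∃ v, IsMildSolution n m p ν v ∧ ∀ r ∈ Icc (0 : ℝ) 1, 0 < v r := by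
  have hq := one_lt_conj hp
  have hp1 : 0 ≤ p - 1 := by linarith
  obtain ⟨M, hM⟩ := isCompact_Icc.exists_bound_of_continuousOn
    (hm.continuousOn (s := Icc (0 : ℝ) 1))
  have hM0 : 0 ≤ M := (norm_nonneg _).trans (hM 0 (by simp))
  obtain ⟨K, hK⟩ := isCompact_Icc.exists_bound_of_continuousOn (s := Icc (0 : ℝ) 1)
    (f := fun t => -flux n m p μ u t * u t ^ (1 - p))
    ((continuous_flux hm hp h.continuous).neg.continuousOn.mul
      (h.continuous.continuousOn.rpow_const fun r hr => Or.inl (hpos r hr).ne'))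
  have hK0 : 0 ≤ K := (norm_nonneg _).trans (hK 0 (by simp))
  set w₀ : ℝ → ℝ := fun t => -(t ^ n * flux n m p μ u t) * u t ^ (1 - p) with hw₀
  set Λ : ℝ := (p - 1) * (p / (p - 1) * (K + 1) ^ (p / (p - 1) - 1)) + 1 with hΛ
  have hΛ0 : 0 < Λ := by
    have : 0 ≤ p / (p - 1) := by linarith
    positivity
  set G : ℝ := M / Λ * Real.exp Λ with hG
  have hG0 : 0 ≤ G := by positivity
  -- Grönwall will give |w - w₀| ≤ |ν - μ| G t^n ≤ t^n. With |w₀| ≤ K t^n, the solution truncated at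
  -- K + 1 never reaches the truncation.
  refine ⟨1 / (G + 1), by positivity, fun ν hν => ?_⟩
  obtain ⟨w, hw0, hw⟩ := exists_riccati_trunc (n := n) (μ := ν) hm hp (K := K + 1) (by linarith)
  refine exists_pos_isMildSolution_of_riccati hm hp (by linarith) hw0 hw fun t ht => ?_
  have hsub : Icc 0 t ⊆ Icc (0 : ℝ) 1 := Icc_subset_Icc_right ht.2
  have hIci : ∀ {f : ℝ → ℝ} {f' s : ℝ}, s ∈ Ico 0 t → HasDerivWithinAt f f' (Icc 0 1) s →
      HasDerivWithinAt f f' (Ici s) s := fun {f f' s} hs hd =>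
    hd.mono_of_mem_nhdsWithin (Icc_mem_nhdsGE_of_mem ⟨hs.1, hs.2.trans_le ht.2⟩)
  have hw₀d : ∀ s ∈ Icc (0 : ℝ) 1,
      HasDerivWithinAt w₀ (riccatiField n m p (K + 1) μ s (w₀ s)) (Icc 0 1) s := by
    intro s hs
    convert! h.riccati hm hp hpos hs using 1
    rw [riccatiField, mul_assoc (p - 1)]
    congr 2
    rcases eq_or_ne (s ^ n) 0 with h0 | h0
    · simp [h0]
    · have e : w₀ s / s ^ n = -flux n m p μ u s * u s ^ (1 - p) := by
        rw [hw₀]; field_simp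
      have hb := hK s hs
      rw [Real.norm_eq_abs] at hb
      rw [e, truncPow_of_le (by linarith)]
  -- Grönwall is applied on [0,t] for each t separately: there w₀ solves the ν-equation with defect
  -- at most |ν - μ| M t^n, and the factor t^n is what controls w / t^n.
  have hgr := dist_le_of_approx_trajectories_ODE (a := 0) (b := t) (δ := 0)
    (εf := 0) (εg := |ν - μ| * M * t ^ n)
    (riccatiField_lipschitz (n := n) (m := m) (μ := ν) hp (K := K + 1) (by linarith))
    (f := w) (fun s hs => ((hw s (hsub hs)).continuousWithinAt).mono hsub)
    (fun s hs => hIci hs (hw s (hsub (Ico_subset_Icc_self hs))))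
    (fun s hs => by rw [dist_self])
    (g := w₀) (fun s hs => ((hw₀d s (hsub hs)).continuousWithinAt).mono hsub)
    (fun s hs => hIci hs (hw₀d s (hsub (Ico_subset_Icc_self hs))))
    (fun s hs => ?_) (by simp [hw0, hw₀, flux_zero]) t (right_mem_Icc.2 ht.1.le)
  · have htn := pow_pos ht.1 n
    rw [Real.coe_toNNReal _ hΛ0.le, gronwallBound_of_K_ne_0 hΛ0.ne', Real.dist_eq] at hgr
    have h1 : |w t - w₀ t| ≤ |ν - μ| * G * t ^ n := by
      refine hgr.trans ?_
      have : Real.exp (Λ * (t - 0)) ≤ Real.exp Λ := by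
        rw [Real.exp_le_exp]; nlinarith [ht.1, ht.2]
      calc _ = |ν - μ| * M * t ^ n / Λ * (Real.exp (Λ * (t - 0)) - 1) := by ring
        _ ≤ |ν - μ| * M * t ^ n / Λ * Real.exp Λ := by gcongr; linarith
        _ = _ := by rw [hG]; ring
    have h2 : |ν - μ| * G ≤ 1 := by
      rw [lt_div_iff₀ (by linarith)] at hν
      nlinarith [abs_nonneg (ν - μ)]
    have h3 : |w₀ t| ≤ K * t ^ n := by
      have hb : |_| ≤ K := hK t ⟨ht.1.le, ht.2⟩
      have e : w₀ t = (-flux n m p μ u t * u t ^ (1 - p)) * t ^ n := by rw [hw₀]; ring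
      rw [e, abs_mul, abs_of_pos htn]
      gcongr
    rw [abs_div, abs_of_pos htn, div_le_iff₀ htn]
    calc |w t| ≤ |w t - w₀ t| + |w₀ t| := by
          have := abs_add_le (w t - w₀ t) (w₀ t); rwa [sub_add_cancel] at this
      _ ≤ 1 * t ^ n + K * t ^ n := by
          refine add_le_add (h1.trans ?_) h3
          gcongr
      _ = (K + 1) * t ^ n := by ring
  · have hms := hM s (hsub (Ico_subset_Icc_self hs))
    rw [Real.norm_eq_abs] at hms
    have e : riccatiField n m p (K + 1) μ s (w₀ s) - riccatiField n m p (K + 1) ν s (w₀ s)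
        = (ν - μ) * m s * s ^ n := by simp only [riccatiField]; ring
    rw [Real.dist_eq, e, abs_mul, abs_mul, abs_of_nonneg (pow_nonneg hs.1 n)]
    have := hs.1
    have := hs.2.le
    gcongr

end Openness

/-! ### Closedness of the eigenvalue set and continuation of positive solutions. -/

section Eigenvalues

variable {n : ℕ} {m : ℝ → ℝ} {p μ : ℝ} {u : ℝ → ℝ}

lemma IsMildSolution.exists_normalized (h : IsMildSolution n m p μ u) (hp : 1 < p)
    (hne : ∃ r ∈ Icc (0 : ℝ) 1, u r ≠ 0) :
    ∃ c > 0, IsMildSolution n m p μ (fun r => c * u r) ∧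
      (∀ r ∈ Icc (0 : ℝ) 1, |c * u r| ≤ 1) ∧ ∃ r ∈ Icc (0 : ℝ) 1, |c * u r| = 1 := by
  obtain ⟨r₁, hr₁, hmax⟩ := isCompact_Icc.exists_isMaxOn ⟨0, left_mem_Icc.2 zero_le_one⟩
    (h.continuous.abs.continuousOn (s := Icc (0 : ℝ) 1))
  have hA : ∀ r ∈ Icc (0 : ℝ) 1, |u r| ≤ |u r₁| := fun r hr => hmax hr
  have hA0 : 0 < |u r₁| := by
    obtain ⟨r, hr, hur⟩ := hne
    exact (abs_pos.2 hur).trans_le (hA r hr)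
  have hc : 0 < |u r₁|⁻¹ := inv_pos.2 hA0
  refine ⟨|u r₁|⁻¹, hc, h.smul hp hc, fun r hr => ?_, r₁, hr₁, ?_⟩
  · rw [abs_mul, abs_of_pos hc, inv_mul_le_one₀ hA0]
    exact hA r hr
  · rw [abs_mul, abs_of_pos hc, inv_mul_cancel₀ hA0.ne']

/-- Nontrivial solutions converge, after rescaling and up to a subsequence, to a nontrivial one. -/
lemma exists_tendsto_smul_isMildSolution (hm : Continuous m) {p μ : ℕ → ℝ} {u : ℕ → ℝ → ℝ}
    {p₀ μ₀ : ℝ} (hp₀ : 1 < p₀) (hp : ∀ k, 1 < p k) (hpt : Tendsto p atTop (𝓝 p₀))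
    (hμt : Tendsto μ atTop (𝓝 μ₀)) (hsol : ∀ k, IsMildSolution n m (p k) (μ k) (u k))
    (hne : ∀ k, ∃ r ∈ Icc (0 : ℝ) 1, u k r ≠ 0) :
    ∃ v, IsMildSolution n m p₀ μ₀ v ∧ (∃ r ∈ Icc (0 : ℝ) 1, v r ≠ 0) ∧
      ∃ (φ : ℕ → ℕ) (c : ℕ → ℝ), (∀ k, 0 < c k) ∧
        ∀ r ∈ Icc (0 : ℝ) 1, Tendsto (fun k => c k * u (φ k) r) atTop (𝓝 (v r)) := by
  choose c hc hcs hcb hc1 using fun k => (hsol k).exists_normalized (hp k) (hne k)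
  obtain ⟨v, hv, φ, -, hunif⟩ :=
    exists_subseq_tendsto_isMildSolution hm hp₀ hp hpt hμt hcs hcb
  refine ⟨v, hv, ?_, φ, fun k => c (φ k), fun k => hc _, fun r hr => hunif.tendsto_at hr⟩
  by_contra! hv0
  -- Each rescaled solution has sup norm 1, so a uniform limit cannot be zero.
  obtain ⟨k, hk⟩ := (Metric.tendstoUniformlyOn_iff.1 hunif 1 one_pos).exists
  obtain ⟨r, hr, hr1⟩ := hc1 (φ k)
  have := hk r hr
  rw [hv0 r hr, dist_zero_left, Real.norm_eq_abs, hr1] at this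
  exact lt_irrefl _ this

/-- Eigenvalues of the integral form of the problem. -/
def IsMildEigenvalue (n : ℕ) (m : ℝ → ℝ) (p μ : ℝ) : Prop :=
  ∃ u, IsMildSolution n m p μ u ∧ u 1 = 0 ∧ ∃ r ∈ Icc (0 : ℝ) 1, u r ≠ 0

lemma IsMildSolution.eq_apply_zero (h : IsMildSolution n m p 0 u) {r : ℝ}
    (hr : r ∈ Icc (0 : ℝ) 1) : u r = u 0 := by
  rw [h.eqn r hr]
  simp [flux, phi_zero]

lemma isMildSolution_one : IsMildSolution n m p 0 fun _ => 1 :=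
  ⟨continuous_const, fun r _ => by simp [flux, phi_zero]⟩

/-- For μ = 0 solutions are constant. This keeps limits of positive eigenvalues positive. -/
lemma not_isMildEigenvalue_zero : ¬IsMildEigenvalue n m p 0 := by
  rintro ⟨u, hu, hu1, r, hr, hur⟩
  exact hur (by rw [hu.eq_apply_zero hr, ← hu.eq_apply_zero (right_mem_Icc.2 zero_le_one), hu1])

/-- The set of pairs (exponent, eigenvalue) is sequentially closed. -/
lemma IsMildEigenvalue.of_tendsto (hm : Continuous m) {p μ : ℕ → ℝ} {p₀ μ₀ : ℝ} (hp₀ : 1 < p₀)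
    (hp : ∀ k, 1 < p k) (hpt : Tendsto p atTop (𝓝 p₀)) (hμt : Tendsto μ atTop (𝓝 μ₀))
    (h : ∀ k, IsMildEigenvalue n m (p k) (μ k)) : IsMildEigenvalue n m p₀ μ₀ := by
  choose u hu hu1 hne using h
  obtain ⟨v, hv, hvne, φ, c, -, hlim⟩ := exists_tendsto_smul_isMildSolution hm hp₀ hp hpt hμt hu hne
  refine ⟨v, hv, ?_, hvne⟩
  refine tendsto_nhds_unique (hlim 1 (by simp)) ?_
  simp [hu1]

/-- Below the first positive eigenvalue there are positive solutions. -/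
theorem exists_pos_isMildSolution (hm : Continuous m) (hp : 1 < p) {c : ℝ} (hc : 0 ≤ c)
    (hno : ∀ μ ∈ Ioc 0 c, ¬IsMildEigenvalue n m p μ) :
    ∃ u, IsMildSolution n m p c u ∧ ∀ r ∈ Icc (0 : ℝ) 1, 0 < u r := by
  let S : Set ℝ := {μ | ∃ u, IsMildSolution n m p μ u ∧ ∀ r ∈ Icc (0 : ℝ) 1, 0 < u r}
  have h0S : (0 : ℝ) ∈ S := ⟨_, isMildSolution_one, fun _ _ => one_pos⟩
  suffices h : Icc 0 c ⊆ S from h (right_mem_Icc.2 hc)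
  -- Continuation in the parameter, starting from the constant solution at μ = 0: the set is closed
  -- in [0,c] and open to the right.
  refine IsClosed.Icc_subset_of_forall_exists_gt ?_ h0S ?_
  · refine IsSeqClosed.isClosed fun μ μ₀ hμ hμt => ?_
    have hμ₀ : μ₀ ∈ Icc 0 c := isClosed_Icc.mem_of_tendsto hμt (.of_forall fun k => (hμ k).2)
    refine ⟨?_, hμ₀⟩
    rcases eq_or_lt_of_le hμ₀.1 with h0 | h0
    · rwa [← h0]
    choose u hu hupos using fun k => (hμ k).1
    obtain ⟨v, hv, hvne, φ, a, ha, hlim⟩ := exists_tendsto_smul_isMildSolution hm hp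
      (fun _ => hp) tendsto_const_nhds hμt hu fun k => ⟨0, by simp, (hupos k 0 (by simp)).ne'⟩
    have hv0 : ∀ r ∈ Icc (0 : ℝ) 1, 0 ≤ v r := fun r hr =>
      ge_of_tendsto' (hlim r hr) fun k => (mul_pos (ha k) (hupos (φ k) r hr)).le
    refine ⟨v, hv, fun r hr => lt_of_le_of_ne (hv0 r hr) fun hvr => ?_⟩
    -- A zero of the limit at r = 1 would make μ₀ an excluded eigenvalue; a zero at r < 1 would make
    -- the limit vanish identically.
    rcases eq_or_lt_of_le hr.2 with h1 | h1
    · exact hno μ₀ ⟨h0, hμ₀.2⟩ ⟨v, hv, by rw [← h1, ← hvr], hvne⟩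
    · obtain ⟨s, hs, hvs⟩ := hvne
      exact hvs (hv.eq_zero_of_nonneg hm hp hv0 ⟨hr.1, h1⟩ hvr.symm s hs)
  · rintro μ ⟨⟨u, hu, hupos⟩, -⟩ y hy
    obtain ⟨ε, hε, h⟩ := hu.exists_pos_near hm hp hupos
    have hy : μ < y := hy
    have hδ : 0 < min (ε / 2) (y - μ) := lt_min (by linarith) (by linarith)
    refine ⟨μ + min (ε / 2) (y - μ), h _ ?_, by linarith, ?_⟩
    · rw [add_sub_cancel_left, abs_of_pos hδ]
      linarith [min_le_left (ε / 2) (y - μ)]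
    · linarith [min_le_right (ε / 2) (y - μ)]

end Eigenvalues

/-! ### Picone's inequality and the energy identity. -/

section Picone

variable {n : ℕ} {m : ℝ → ℝ} {p μ : ℝ} {u v v' : ℝ → ℝ}

/-- Young's inequality for y and z φ_p(x), multiplied by p. It is used with x = v, y = v' and z =
φ_p(u'/u). -/
lemma picone_pointwise (hp : 1 < p) (x y z : ℝ) :
    z * (p * |x| ^ (p - 2) * x * y) ≤ |y| ^ p + (p - 1) * |z| ^ (p / (p - 1)) * |x| ^ p := by
  have hq := one_lt_conj hp
  have hpq : p.HolderConjugate (p / (p - 1)) := Real.HolderConjugate.conjExponent hp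
  have hY := Real.young_inequality y (z * phi p x) hpq
  have e1 : |z * phi p x| ^ (p / (p - 1)) = |z| ^ (p / (p - 1)) * |x| ^ p := by
    rw [abs_mul, Real.mul_rpow (abs_nonneg _) (abs_nonneg _), abs_phi hp,
      ← Real.rpow_mul (abs_nonneg x)]
    congr 2
    have : p - 1 ≠ 0 := by linarith
    field_simp
  have h2 := mul_le_mul_of_nonneg_left hY (show 0 ≤ p by linarith)
  have e3 : p * (|y| ^ p / p + |z * phi p x| ^ (p / (p - 1)) / (p / (p - 1)))
      = |y| ^ p + (p - 1) * |z| ^ (p / (p - 1)) * |x| ^ p := by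
    rw [e1]
    have : p - 1 ≠ 0 := by linarith
    have : p ≠ 0 := by linarith
    field_simp
  rw [e3] at h2
  refine le_trans (le_of_eq ?_) h2
  rw [phi]
  ring

/-- Picone's inequality, integrated against a positive solution. -/
theorem IsMildSolution.picone (h : IsMildSolution n m p μ u) (hm : Continuous m) (hp : 1 < p)
    (hpos : ∀ r ∈ Icc (0 : ℝ) 1, 0 < u r) (hv : Continuous v) (hv' : Continuous v')
    (hd : ∀ r ∈ Ioo (0 : ℝ) 1, HasDerivAt v (v' r) r) (hv1 : v 1 = 0) :
    μ * ∫ t in (0 : ℝ)..1, t ^ n * m t * |v t| ^ p ≤ ∫ t in (0 : ℝ)..1, t ^ n * |v' t| ^ p := by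
  have hq := one_lt_conj hp
  have hF := continuous_flux (n := n) (μ := μ) hm hp h.continuous
  obtain ⟨F, hFdef⟩ : ∃ F, F = flux n m p μ u := ⟨_, rfl⟩
  rw [← hFdef] at hF
  have hup : ContinuousOn (fun t => u t ^ (1 - p)) (Icc 0 1) :=
    h.continuous.continuousOn.rpow_const fun r hr => Or.inl (hpos r hr).ne'
  have hz : ContinuousOn (fun t => -F t * u t ^ (1 - p)) (Icc 0 1) := by fun_prop
  have hwc : ContinuousOn (fun t => -(t ^ n * F t) * u t ^ (1 - p)) (Icc 0 1) :=
    ContinuousOn.mul (by fun_prop) hup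
  have hvp : Continuous fun t => |v t| ^ p :=
    hv.abs.rpow_const fun _ => Or.inr (by linarith)
  have hv'p : Continuous fun t => |v' t| ^ p :=
    hv'.abs.rpow_const fun _ => Or.inr (by linarith)
  have hzq : ContinuousOn (fun t => |-F t * u t ^ (1 - p)| ^ (p / (p - 1))) (Icc 0 1) :=
    hz.abs.rpow_const fun _ _ => Or.inr (by linarith)
  have hvφ : Continuous fun t => p * |v t| ^ (p - 2) * v t := by
    have : (fun t => p * |v t| ^ (p - 2) * v t) = fun t => p * phi p (v t) := by
      funext t; rw [phi, mul_assoc]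
    rw [this]
    exact ((continuous_phi hp).comp hv).const_mul p
  -- The derivative of w |v|^p, where w is the Riccati function of u. Its integral is zero, since
  -- w(0) = 0 and v(1) = 0.
  set g : ℝ → ℝ := fun t => (-(μ * m t * t ^ n)
        - (p - 1) * t ^ n * |-F t * u t ^ (1 - p)| ^ (p / (p - 1))) * |v t| ^ p
      + -(t ^ n * F t) * u t ^ (1 - p) * (p * |v t| ^ (p - 2) * v t * v' t) with hg
  have hgc : ContinuousOn g (Icc 0 1) := by
    refine ContinuousOn.add (ContinuousOn.mul ?_ hvp.continuousOn)
      (hwc.mul (hvφ.mul hv').continuousOn)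
    exact ContinuousOn.sub (by fun_prop) (ContinuousOn.mul (by fun_prop) hzq)
  have hI := intervalIntegral.integral_eq_sub_of_hasDerivAt_of_le zero_le_one
    (f := fun t => -(t ^ n * F t) * u t ^ (1 - p) * |v t| ^ p) (f' := g) (hwc.mul hvp.continuousOn)
    (fun t ht => ?_) (hgc.intervalIntegrable_of_Icc zero_le_one)
  · have hF0 : F 0 = 0 := by rw [hFdef, flux_zero]
    simp only [hv1, hF0, abs_zero, Real.zero_rpow (show p ≠ 0 by linarith), mul_zero, neg_zero,
      zero_mul, sub_zero] at hI
    have hle : ∫ t in (0 : ℝ)..1, g t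
        ≤ ∫ t in (0 : ℝ)..1, (t ^ n * |v' t| ^ p - μ * (t ^ n * m t * |v t| ^ p)) := by
      refine intervalIntegral.integral_mono_on zero_le_one
        (hgc.intervalIntegrable_of_Icc zero_le_one)
        (Continuous.intervalIntegrable (by fun_prop) _ _) fun t ht => ?_
      have h1 := mul_le_mul_of_nonneg_left
        (picone_pointwise hp (v t) (v' t) (-F t * u t ^ (1 - p))) (pow_nonneg ht.1 n)
      simp only [hg]
      linarith
    rw [hI, intervalIntegral.integral_sub (Continuous.intervalIntegrable (by fun_prop) _ _)
      (Continuous.intervalIntegrable (by fun_prop) _ _), intervalIntegral.integral_const_mul] at hle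
    linarith
  · have h1 := (h.riccati hm hp hpos (Ioo_subset_Icc_self ht)).hasDerivAt
      (Icc_mem_nhds ht.1 ht.2)
    have h2 := (hasDerivAt_abs_rpow (v t) hp).comp t (hd t ht)
    simp only [hg, hFdef]
    exact h1.mul h2

/-- The energy identity for eigenfunctions. -/
theorem IsMildSolution.energy (h : IsMildSolution n m p μ u) (hm : Continuous m) (hp : 1 < p)
    (hu1 : u 1 = 0) :
    ∫ t in (0 : ℝ)..1, t ^ n * |-phi (p / (p - 1)) (flux n m p μ u t)| ^ p
      = μ * ∫ t in (0 : ℝ)..1, t ^ n * m t * |u t| ^ p := by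
  have hq := one_lt_conj hp
  have hF := continuous_flux (n := n) (μ := μ) hm hp h.continuous
  have huc := h.continuous
  have hψ : Continuous fun t => |-phi (p / (p - 1)) (flux n m p μ u t)| ^ p :=
    ((continuous_phi hq).comp hF).neg.abs.rpow_const fun _ => Or.inr (by linarith)
  have hup : Continuous fun t => |u t| ^ p :=
    huc.abs.rpow_const fun _ => Or.inr (by linarith)
  -- The equation is tested with u itself; the boundary terms vanish because the flux is 0 at the
  -- origin and u(1) = 0.
  have hI := intervalIntegral.integral_eq_sub_of_hasDerivAt_of_le zero_le_one
    (f := fun t => t ^ n * flux n m p μ u t * u t)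
    (f' := fun t => μ * (t ^ n * m t * |u t| ^ p)
      - t ^ n * |-phi (p / (p - 1)) (flux n m p μ u t)| ^ p) (by fun_prop)
    (fun t ht => ?_) (Continuous.intervalIntegrable (by fun_prop) _ _)
  · rw [intervalIntegral.integral_sub (Continuous.intervalIntegrable (by fun_prop) _ _)
      (Continuous.intervalIntegrable (by fun_prop) _ _), intervalIntegral.integral_const_mul,
      hu1, flux_zero] at hI
    linarith
  · convert! (hasDerivAt_pow_mul_flux hm hp huc t).mul (h.hasDerivAt hm hp ht) using 1
    rw [abs_neg, ← phi_mul_self hp, ← phi_mul_self hp, phi_phi_conj hp]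
    ring

/-- Zero energy would force u' = 0, and then u = u(1) = 0. With the energy identity, this makes ∫
t^n m |u|^p positive when μ > 0. -/
lemma IsMildSolution.energy_pos (h : IsMildSolution n m p μ u) (hm : Continuous m) (hp : 1 < p)
    (hu1 : u 1 = 0) (hne : ∃ r ∈ Icc (0 : ℝ) 1, u r ≠ 0) :
    0 < ∫ t in (0 : ℝ)..1, t ^ n * |-phi (p / (p - 1)) (flux n m p μ u t)| ^ p := by
  have hq := one_lt_conj hp
  have hF := continuous_flux (n := n) (μ := μ) hm hp h.continuous
  have hψ : Continuous fun t => |-phi (p / (p - 1)) (flux n m p μ u t)| ^ p :=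
    ((continuous_phi hq).comp hF).neg.abs.rpow_const fun _ => Or.inr (by linarith)
  refine intervalIntegral.integral_pos zero_lt_one (by fun_prop)
    (fun t ht => mul_nonneg (pow_nonneg ht.1.le n) (Real.rpow_nonneg (abs_nonneg _) _)) ?_
  by_contra! hle
  have hz : ∀ t ∈ Icc (0 : ℝ) 1, phi (p / (p - 1)) (flux n m p μ u t) = 0 := by
    intro t ht
    rcases eq_or_lt_of_le ht.1 with h0 | h0
    · rw [← h0, flux_zero, phi_zero]
    · by_contra hne
      have : 0 < |-phi (p / (p - 1)) (flux n m p μ u t)| := abs_pos.2 (neg_ne_zero.2 hne)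
      have := mul_pos (pow_pos h0 n) (Real.rpow_pos_of_pos this p)
      linarith [hle t ht]
  have hconst : ∀ r ∈ Icc (0 : ℝ) 1, u r = u 0 := by
    intro r hr
    rw [h.eqn r hr, intervalIntegral.integral_congr (g := fun _ => 0), intervalIntegral.integral_zero,
      sub_zero]
    intro t ht
    rw [uIcc_of_le hr.1] at ht
    exact hz t ⟨ht.1, ht.2.trans hr.2⟩
  obtain ⟨r, hr, hur⟩ := hne
  exact hur (by rw [hconst r hr, ← hconst 1 (by simp), hu1])

end Picone

/-! ### Existence and continuity of the least positive eigenvalue. -/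

section PrincipalEigenvalue

variable {n : ℕ} {m : ℝ → ℝ} {p : ℝ} {v v' : ℝ → ℝ}

/-- The positive eigenvalues of the integral form of the problem. -/
def posMildEigenvalues (n : ℕ) (m : ℝ → ℝ) (p : ℝ) : Set ℝ := {μ | 0 < μ ∧ IsMildEigenvalue n m p μ}

/-- Otherwise a positive solution exists at the parameter c, and Picone's inequality against it
contradicts the assumed strict inequality. -/
lemma exists_mem_posMildEigenvalues_le (hm : Continuous m) (hp : 1 < p) (hv : Continuous v)
    (hv' : Continuous v') (hd : ∀ r ∈ Ioo (0 : ℝ) 1, HasDerivAt v (v' r) r) (hv1 : v 1 = 0)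
    {c : ℝ} (hc : 0 < c)
    (h : ∫ t in (0 : ℝ)..1, t ^ n * |v' t| ^ p < c * ∫ t in (0 : ℝ)..1, t ^ n * m t * |v t| ^ p) :
    ∃ μ ∈ posMildEigenvalues n m p, μ ≤ c := by
  by_contra! hno
  obtain ⟨u, hu, hpos⟩ := exists_pos_isMildSolution (n := n) hm hp hc.le
    fun μ hμ he => absurd hμ.2 (hno μ ⟨hμ.1, he⟩).not_ge
  exact absurd (hu.picone hm hp hpos hv hv' hd hv1) h.not_ge

/-- A smooth bump supported in a ball on which m > 0. -/
lemma exists_testFunction (hm : Continuous m) (hp : 1 < p)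
    (hpos : ∃ r ∈ Ioo (0 : ℝ) 1, 0 < m r) :
    ∃ v v' : ℝ → ℝ, Continuous v ∧ Continuous v' ∧ (∀ r, HasDerivAt v (v' r) r) ∧ v 1 = 0 ∧
      0 < ∫ t in (0 : ℝ)..1, t ^ n * m t * |v t| ^ p := by
  obtain ⟨r₀, hr₀, hmr⟩ := hpos
  have hnhds : {r | 0 < m r} ∩ Ioo (0 : ℝ) 1 ∈ 𝓝 r₀ :=
    inter_mem ((isOpen_lt continuous_const hm).mem_nhds hmr) (Ioo_mem_nhds hr₀.1 hr₀.2)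
  obtain ⟨ε, hε, hball⟩ := Metric.nhds_basis_closedBall.mem_iff.1 hnhds
  let f : ContDiffBump r₀ := ⟨ε / 2, ε, by linarith, by linarith⟩
  have hf : ContDiff ℝ 1 f := f.contDiff
  have hf0 : ∀ r, r ∉ Metric.ball r₀ ε → f r = 0 := fun r hr => by
    have : r ∉ Function.support f := by rw [f.support_eq]; exact hr
    simpa using this
  refine ⟨f, deriv f, hf.continuous, hf.continuous_deriv le_rfl,
    fun r => (hf.differentiable one_ne_zero r).hasDerivAt, hf0 1 fun h => ?_, ?_⟩
  · exact absurd (hball (Metric.ball_subset_closedBall h)).2.2 (lt_irrefl _)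
  · have hfp : Continuous fun t => |f t| ^ p :=
      hf.continuous.abs.rpow_const fun _ => Or.inr (by linarith)
    refine intervalIntegral.integral_pos zero_lt_one (by fun_prop) (fun t ht => ?_)
      ⟨r₀, Ioo_subset_Icc_self hr₀, ?_⟩
    · by_cases hb : t ∈ Metric.ball r₀ ε
      · have : 0 < m t := (hball (Metric.ball_subset_closedBall hb)).1
        have := ht.1.le
        positivity
      · rw [hf0 t hb, abs_zero, Real.zero_rpow (by linarith), mul_zero]
    · rw [f.one_of_mem_closedBall (Metric.mem_closedBall_self (by change 0 ≤ ε / 2; linarith)), abs_one,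
        Real.one_rpow, mul_one]
      exact mul_pos (pow_pos hr₀.1 n) hmr

lemma continuousAt_integral_abs_rpow {g w : ℝ → ℝ} (hg : Continuous g) (hw : Continuous w)
    (hp : 1 < p) : ContinuousAt (fun p => ∫ t in (0 : ℝ)..1, g t * |w t| ^ p) p := by
  -- Replacing p by max p 1 keeps the exponent positive for every real p, so zeros of w cause no
  -- discontinuity.
  have hc : Continuous fun p : ℝ => ∫ t in (0 : ℝ)..1, g t * |w t| ^ max p 1 := by
    apply intervalIntegral.continuous_parametric_intervalIntegral_of_continuous'
    simp only [Function.uncurry_def]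
    refine (hg.comp continuous_snd).mul (Continuous.rpow (by fun_prop) (by fun_prop) fun x => ?_)
    exact Or.inr (lt_max_of_lt_right one_pos)
  refine hc.continuousAt.congr ?_
  filter_upwards [lt_mem_nhds hp] with q hq
  rw [max_eq_left hq.le]

/-- The positive principal eigenvalue exists. -/
theorem isLeast_posMildEigenvalues (hm : Continuous m) (hpos : ∃ r ∈ Ioo (0 : ℝ) 1, 0 < m r)
    (hp : 1 < p) : IsLeast (posMildEigenvalues n m p) (sInf (posMildEigenvalues n m p)) := by
  have hbdd : BddBelow (posMildEigenvalues n m p) := ⟨0, fun μ hμ => hμ.1.le⟩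
  have hne : (posMildEigenvalues n m p).Nonempty := by
    obtain ⟨v, v', hv, hv', hd, hv1, hG⟩ := exists_testFunction (n := n) hm hp hpos
    set G := ∫ t in (0 : ℝ)..1, t ^ n * m t * |v t| ^ p
    set E := ∫ t in (0 : ℝ)..1, t ^ n * |v' t| ^ p with hE
    have hE0 : 0 ≤ E := intervalIntegral.integral_nonneg zero_le_one fun t ht =>
      mul_nonneg (pow_nonneg ht.1 n) (Real.rpow_nonneg (abs_nonneg _) _)
    obtain ⟨μ, hμ, -⟩ := exists_mem_posMildEigenvalues_le (n := n) (c := (E + 1) / G) hm hp hv hv'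
      (fun r _ => hd r) hv1 (by positivity) (by rw [div_mul_cancel₀ _ hG.ne']; linarith)
    exact ⟨μ, hμ⟩
  refine ⟨?_, fun μ hμ => csInf_le hbdd hμ⟩
  obtain ⟨μ, -, hμt, hμ⟩ := exists_seq_tendsto_sInf hne hbdd
  have he : IsMildEigenvalue n m p (sInf (posMildEigenvalues n m p)) :=
    .of_tendsto hm hp (fun _ => hp) tendsto_const_nhds hμt fun k => (hμ k).2
  refine ⟨lt_of_le_of_ne (le_csInf hne fun μ hμ => hμ.1.le) fun h0 => ?_, he⟩
  rw [← h0] at he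
  exact not_isMildEigenvalue_zero he

/-- The positive principal eigenvalue is continuous in the exponent. -/
theorem continuousOn_sInf_posMildEigenvalues (hm : Continuous m)
    (hpos : ∃ r ∈ Ioo (0 : ℝ) 1, 0 < m r) :
    ContinuousOn (fun p => sInf (posMildEigenvalues n m p)) (Ioi 1) := by
  intro p hp
  have hp : 1 < p := hp
  refine ContinuousAt.continuousWithinAt ?_
  have hleast : ∀ q, 1 < q →
      IsLeast (posMildEigenvalues n m q) (sInf (posMildEigenvalues n m q)) :=
    fun q hq => isLeast_posMildEigenvalues hm hpos hq
  rw [ContinuousAt, tendsto_order]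
  constructor
  -- Lower semicontinuity: otherwise, along some exponents tending to p, the least eigenvalues stay
  -- in [0,c], and a limit point is a positive eigenvalue at p below the least one.
  · intro c hc
    by_contra hcon
    have hfreq : ∃ᶠ q in 𝓝 p, 1 < q ∧ sInf (posMildEigenvalues n m q) ≤ c := by
      refine ((not_eventually.1 hcon).and_eventually (lt_mem_nhds hp)).mono fun q hq => ?_
      exact ⟨hq.2, not_lt.1 hq.1⟩
    obtain ⟨q, hqt, hq⟩ := exists_seq_forall_of_frequently hfreq
    obtain ⟨μ, -, φ, hφ, hμt⟩ := (isCompact_Icc (a := (0 : ℝ)) (b := c)).tendsto_subseq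
      (x := fun k => sInf (posMildEigenvalues n m (q k)))
      fun k => ⟨(hleast _ (hq k).1).1.1.le, (hq k).2⟩
    have he : IsMildEigenvalue n m p μ :=
      .of_tendsto hm hp (fun k => (hq (φ k)).1) (hqt.comp hφ.tendsto_atTop) hμt
        fun k => (hleast _ (hq (φ k)).1).1.2
    have hμ0 : 0 ≤ μ := ge_of_tendsto' hμt fun k => (hleast _ (hq (φ k)).1).1.1.le
    have hμc : μ ≤ c := le_of_tendsto' hμt fun k => (hq (φ k)).2
    have hμpos : 0 < μ := lt_of_le_of_ne hμ0 fun h0 => by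
      rw [← h0] at he
      exact not_isMildEigenvalue_zero he
    exact absurd ((hleast p hp).2 ⟨hμpos, he⟩) (by linarith)
  -- Upper semicontinuity: for b slightly above μ, the eigenfunction at p satisfies the test
  -- inequality strictly, and so still does for nearby exponents.
  · intro c hc
    obtain ⟨hμ0, v, hv, hv1, hne⟩ := (hleast p hp).1
    set μ := sInf (posMildEigenvalues n m p)
    set v' : ℝ → ℝ := fun t => -phi (p / (p - 1)) (flux n m p μ v t) with hv'
    have hv'c : Continuous v' :=
      ((continuous_phi (one_lt_conj hp)).comp (continuous_flux hm hp hv.continuous)).neg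
    have hE := hv.energy_pos hm hp hv1 hne
    have hEG := hv.energy hm hp hv1
    obtain ⟨b, hμb, hbc⟩ := exists_between hc
    have hlt : ∫ t in (0 : ℝ)..1, t ^ n * |v' t| ^ p
        < b * ∫ t in (0 : ℝ)..1, t ^ n * m t * |v t| ^ p := by
      have hG : 0 < ∫ t in (0 : ℝ)..1, t ^ n * m t * |v t| ^ p := by
        rw [hEG] at hE
        exact pos_of_mul_pos_right hE hμ0.le
      rw [hEG]
      exact mul_lt_mul_of_pos_right hμb hG
    have h1 := continuousAt_integral_abs_rpow (continuous_pow n) hv'c hp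
    have h2 := (continuousAt_integral_abs_rpow ((continuous_pow n).mul hm) hv.continuous hp).const_mul b
    filter_upwards [h1.eventually_lt h2 hlt, lt_mem_nhds hp] with q hq hq1
    obtain ⟨ν, hν, hνb⟩ := exists_mem_posMildEigenvalues_le hm hq1 hv.continuous hv'c
      (fun r hr => hv.hasDerivAt hm hp hr) hv1 (hμ0.trans hμb) hq
    exact ((hleast q hq1).2 hν).trans_lt (hνb.trans_lt hbc)

end PrincipalEigenvalue

/-! ### Equivalence with the original problem, and the reflection m ↦ -m. -/

section Equivalence

variable {N : ℕ} {m m' : ℝ → ℝ} {p μ : ℝ} {u : ℝ → ℝ}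

lemma IsMildSolution.isRadialSolution (hm' : Continuous m') (hmm : EqOn m m' (Icc 0 1))
    (hp : 1 < p) (h : IsMildSolution (N - 1) m' p μ u) (hu1 : u 1 = 0) :
    IsRadialSolution N m p μ u := by
  have hq := one_lt_conj hp
  have hU : UniqueDiffOn ℝ (Icc (0 : ℝ) 1) := uniqueDiffOn_Icc zero_lt_one
  have hF := continuous_flux (n := N - 1) (μ := μ) hm' hp h.continuous
  have hderiv : ∀ r ∈ Icc (0 : ℝ) 1,
      derivWithin u (Icc 0 1) r = -phi (p / (p - 1)) (flux (N - 1) m' p μ u r) := fun r hr =>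
    (h.hasDerivWithinAt hm' hp hr).derivWithin (hU r hr)
  have hfl : EqOn (fun r : ℝ => r ^ (N - 1) * phi p (derivWithin u (Icc 0 1) r))
      (fun r => -(r ^ (N - 1) * flux (N - 1) m' p μ u r)) (Icc 0 1) := fun r hr => by
    simp only [hderiv r hr, phi_neg, phi_phi_conj hp, mul_neg]
  have hd : ∀ r, HasDerivAt (fun r => -(r ^ (N - 1) * flux (N - 1) m' p μ u r))
      (-(μ * m' r * r ^ (N - 1) * phi p (u r))) r := fun r =>
    (hasDerivAt_pow_mul_flux hm' hp h.continuous r).neg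
  refine ⟨?_, ?_, hu1, ?_, ?_⟩
  · refine (contDiffOn_one_iff_derivWithin hU).2
      ⟨fun r hr => (h.hasDerivWithinAt hm' hp hr).differentiableWithinAt, ?_⟩
    exact ((continuous_phi hq).comp hF).neg.continuousOn.congr hderiv
  · rw [hderiv 0 (by simp), flux_zero, phi_zero, neg_zero]
  · refine ContDiffOn.absolutelyContinuousOnInterval ?_
    rw [uIcc_of_le zero_le_one]
    refine ContDiffOn.congr (ContDiff.contDiffOn ?_) hfl
    refine contDiff_one_iff_deriv.2 ⟨fun r => (hd r).differentiableAt, ?_⟩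
    rw [funext fun r => (hd r).deriv]
    have := (continuous_phi hp).comp h.continuous
    simp only [Function.comp_def] at this
    fun_prop
  · refine (ae_restrict_iff' measurableSet_Ioo).2 (.of_forall fun r hr => ?_)
    rw [hmm (Ioo_subset_Icc_self hr)]
    exact (hd r).congr_of_eventuallyEq (hfl.eventuallyEq_of_mem (Icc_mem_nhds hr.1 hr.2))

/-- Absolute continuity lets the a.e. equation be integrated from 0; dividing by r^(N-1) for r > 0
and inverting φ_p recovers u'. -/
lemma IsRadialSolution.isMildSolution (hm' : Continuous m') (hmm : EqOn m m' (Icc 0 1))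
    (hp : 1 < p) (h : IsRadialSolution N m p μ u) :
    ∃ v, IsMildSolution (N - 1) m' p μ v ∧ EqOn v u (Icc 0 1) := by
  have hU : UniqueDiffOn ℝ (Icc (0 : ℝ) 1) := uniqueDiffOn_Icc zero_lt_one
  set v : ℝ → ℝ := IccExtend zero_le_one ((Icc (0 : ℝ) 1).domRestrict u) with hv
  have hvc : Continuous v := h.contDiffOn.continuousOn.domRestrict.Icc_extend'
  have hvu : EqOn v u (Icc 0 1) := fun r hr => by rw [hv, IccExtend_of_mem _ _ hr]; rfl
  refine ⟨v, .of_hasDerivAt hm' hp hvc fun r hr => ?_, hvu⟩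
  have hrI := Ioo_subset_Icc_self hr
  have hAC : AbsolutelyContinuousOnInterval
      (fun r : ℝ => r ^ (N - 1) * phi p (derivWithin u (Icc 0 1) r)) 0 r := by
    refine h.absolutelyContinuous.mono ?_
    rw [uIcc_of_le hr.1.le, uIcc_of_le zero_le_one]
    exact Icc_subset_Icc_right hr.2.le
  have hI := hAC.integral_deriv_eq_sub
  have hcongr : ∫ x in (0 : ℝ)..r,
      deriv (fun r : ℝ => r ^ (N - 1) * phi p (derivWithin u (Icc 0 1) r)) x
      = ∫ x in (0 : ℝ)..r, -(μ * m' x * x ^ (N - 1) * phi p (v x)) := by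
    refine intervalIntegral.integral_congr_ae ?_
    filter_upwards [(ae_restrict_iff' measurableSet_Ioo).1 h.equation] with x hx hxr
    rw [uIoc_of_le hr.1.le] at hxr
    have hx1 : x ∈ Ioo (0 : ℝ) 1 := ⟨hxr.1, hxr.2.trans_lt hr.2⟩
    have hxI := Ioo_subset_Icc_self hx1
    rw [(hx hx1).deriv, hmm hxI, hvu hxI]
  rw [hcongr, intervalIntegral.integral_neg, ← pow_mul_flux, h.deriv_zero, phi_zero, mul_zero,
    sub_zero, ← mul_neg] at hI
  have hφ := mul_left_cancel₀ (pow_pos hr.1 (N - 1)).ne' hI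
  have hd : derivWithin u (Icc 0 1) r
      = -phi (p / (p - 1)) (flux (N - 1) m' p μ v r) := by
    rw [← phi_neg, hφ, phi_conj_phi hp]
  rw [← hd]
  have hdu := ((h.contDiffOn.differentiableOn one_ne_zero r hrI).hasDerivWithinAt).hasDerivAt
    (Icc_mem_nhds hr.1 hr.2)
  exact hdu.congr_of_eventuallyEq (hvu.eventuallyEq_of_mem (Icc_mem_nhds hr.1 hr.2))

lemma isRadialEigenvalue_iff (hm' : Continuous m') (hmm : EqOn m m' (Icc 0 1)) (hp : 1 < p) :
    IsRadialEigenvalue N m p μ ↔ IsMildEigenvalue (N - 1) m' p μ := by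
  constructor
  · rintro ⟨u, hu, r, hr, hur⟩
    obtain ⟨v, hv, hvu⟩ := hu.isMildSolution hm' hmm hp
    exact ⟨v, hv, by rw [hvu (by simp), hu.apply_one], r, hr, by rwa [hvu hr]⟩
  · rintro ⟨u, hu, hu1, hne⟩
    exact ⟨u, hu.isRadialSolution hm' hmm hp hu1, hne⟩

lemma posEigenvalues_eq (hm' : Continuous m') (hmm : EqOn m m' (Icc 0 1)) (hp : 1 < p) :
    posEigenvalues N m p = posMildEigenvalues (N - 1) m' p := by
  ext μ
  simp only [posEigenvalues, posMildEigenvalues, mem_ofPred_eq, isRadialEigenvalue_iff hm' hmm hp]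

/-- Existence and continuity of the positive principal eigenvalue. -/
theorem isLeast_and_continuousOn_muOnePos (hm : WeightClass m) :
    (∀ p : ℝ, 1 < p → IsLeast (posEigenvalues N m p) (muOnePos N m p)) ∧
      ContinuousOn (muOnePos N m) (Ioi 1) := by
  obtain ⟨hmc, hvol⟩ := hm
  set m' : ℝ → ℝ := IccExtend zero_le_one ((Icc (0 : ℝ) 1).domRestrict m) with hm'
  have hm'c : Continuous m' := hmc.domRestrict.Icc_extend'
  have hmm : EqOn m m' (Icc 0 1) := fun r hr => by rw [hm', IccExtend_of_mem _ _ hr]; rfl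
  have hpos : ∃ r ∈ Ioo (0 : ℝ) 1, 0 < m' r := by
    obtain ⟨r, hr, hmr⟩ := nonempty_of_measure_ne_zero hvol
    exact ⟨r, hr, by rwa [← hmm (Ioo_subset_Icc_self hr)]⟩
  constructor
  · intro p hp
    rw [muOnePos, posEigenvalues_eq hm'c hmm hp]
    exact isLeast_posMildEigenvalues hm'c hpos hp
  · refine (continuousOn_sInf_posMildEigenvalues (n := N - 1) hm'c hpos).congr fun p hp => ?_
    rw [muOnePos, posEigenvalues_eq hm'c hmm hp]

/-- Only the product μ m enters the equation. -/
lemma isRadialEigenvalue_neg :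
    IsRadialEigenvalue N (fun r => -m r) p (-μ) ↔ IsRadialEigenvalue N m p μ := by
  have h : ∀ u, IsRadialSolution N (fun r => -m r) p (-μ) u ↔ IsRadialSolution N m p μ u := by
    intro u
    constructor <;> rintro ⟨h1, h2, h3, h4, h5⟩ <;> refine ⟨h1, h2, h3, h4, ?_⟩ <;>
      simpa only [neg_mul_neg] using h5
  simp only [IsRadialEigenvalue, h]

lemma negEigenvalues_eq_neg : negEigenvalues N m p = -posEigenvalues N (fun r => -m r) p := by
  ext μ
  simp only [negEigenvalues, posEigenvalues, Set.mem_neg, mem_ofPred_eq, neg_pos,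
    isRadialEigenvalue_neg]

lemma muOneNeg_eq_neg : muOneNeg N m p = -muOnePos N (fun r => -m r) p := by
  rw [muOneNeg, muOnePos, negEigenvalues_eq_neg, Real.sInf_def, neg_neg]

end Equivalence

theorem theorem2p2 (N : ℕ) (hN : 1 ≤ N) (m : ℝ → ℝ) (hm : WeightClass m) :
    ((∀ p : ℝ, 1 < p → IsLeast (posEigenvalues N m p) (muOnePos N m p)) ∧
      ContinuousOn (muOnePos N m) (Ioi 1)) ∧
    (volume {r | r ∈ Ioo (0 : ℝ) 1 ∧ m r < 0} ≠ 0 →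
      (∀ p : ℝ, 1 < p → IsGreatest (negEigenvalues N m p) (muOneNeg N m p)) ∧
      ContinuousOn (muOneNeg N m) (Ioi 1)) := by
  refine ⟨isLeast_and_continuousOn_muOnePos hm, fun hvol => ?_⟩
  have hneg : WeightClass fun r => -m r := ⟨hm.1.neg, by simpa only [neg_pos] using hvol⟩
  obtain ⟨hleast, hcont⟩ := isLeast_and_continuousOn_muOnePos (N := N) hneg
  refine ⟨fun p hp => ?_, hcont.neg.congr fun p _ => muOneNeg_eq_neg⟩
  rw [muOneNeg_eq_neg, negEigenvalues_eq_neg]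
  refine ⟨by rw [Set.mem_neg, neg_neg]; exact (hleast p hp).1, fun μ hμ => ?_⟩
  exact le_neg.1 ((hleast p hp).2 hμ)
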